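/- **Theorem.** Let the vertices be $0,\dots,n-1$, and let the shared array $P$ of labels (parent pointers) initially be any array $P_0$ with $P_0[v]\le v$ and $P_0[P_0[v]]=P_0[v]$ for all $v$; for example the identity (empty graph), or the map that sends a vertex to the smallest vertex of its component in an initial graph. *Correctness.* The sequential semantics is that of union-find on connectivity labelings $C:V\to V$, starting from $C=P_0$: $\mathrm{Insert}(u,v)$ (union) does nothing if $C(u)=C(v)$ and otherwise gives all vertices labeled $C(u)$ or $C(v)$ one common label, which is $C(u)$ or $C(v)$; $\mathrm{Find}(u)$ returns $C(u)$; $\mathrm{IsConnected}(u,v)$ returns whether $C(u)=C(v)$. A finite history of invocations and responses is *linearizable* if one can insert into it, for every completed operation and for some of the operations without a response, a point in time after the invocation and before the response (if there is one), such that the operations applied sequentially in the order of these points return the results in the history. An algorithm is correct if each of its histories (with arbitrary interleaving of atomic steps, and any number of threads, each of which executes one operation at a time) is linearizable. **(1) Type (1).** The following union-find algorithms are correct when arbitrary threads concurrently invoke $\mathrm{Insert}$, $\mathrm{Find}$ and $\mathrm{IsConnected}$ at arbitrary times. - *Find options* $F$. FindNaive follows parents to a vertex $v=P[v]$. FindAtomicSplit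 (FindAtomicHalve) repeats: $v\gets P[u]$, $w\gets P[v]$; if $v=w$ return $v$; $\mathrm{CAS}(P[u],v,w)$; $u\gets v$ (resp. $u\gets P[u]$). FindCompress returns $u$ if $P[u]=u$; otherwise it finds the root $r$, then while $(j\gets P[u])>r$ writes $P[u]\gets r$, $u\gets j$, and returns $r$. - *Queries.* $\mathrm{Find}(u)$ is the find option of the algorithm. $\mathrm{IsConnected}(u,v)$ computes $a\gets \mathrm{Find}(u)$, $b\gets\mathrm{Find}(v)$; it returns true if $a=b$; otherwise it returns false if $P[a]=a$ still holds, and else repeats from $(a,b)$. - *UF-Async* (any $F$): repeat: $a\gets F(u)$, $b\gets F(v)$; stop if $a=b$; with $h=\max(a,b)$, $l=\min(a,b)$, stop if $P[h]=h$ and $\mathrm{CAS}(P[h],h,l)$ succeeds. *UF-Hooks* (any $F$): the same, but with $\mathrm{CAS}(H[h],\infty,l)$ on an auxiliary array $H$ (initially $\infty$), followed, on success, by the write $P[h]\gets l$. - *UF-Early* (any $F$): $(a,b)\gets(u,v)$; while $a\ne b$, with $h,l$ as above: leave the loop if $P[h]=h$ and $\mathrm{CAS}(P[h],h,l)$ succeeds;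 otherwise $z\gets P[h]$, $w\gets P[z]$, $\mathrm{CAS}(P[h],z,w)$, $(a,b)\gets(w,l)$. Afterwards execute $F(u)$, $F(v)$ unless $F$ is FindNaive. - *UF-JTB* (FindNaive, or FindTwoTrySplit, which is path splitting with two attempts $v\gets P[u]$, $w\gets P[v]$, $\mathrm{CAS}(P[u],v,w)$ per vertex, and which returns $v$ if $v=w$ at the first attempt): every vertex has a rank (initially $0$) in the same word as its parent. Union repeats: find the roots $a,b$ of the current vertices; stop if $a=b$; read both words; by a CAS of the whole word that expects a root with the rank just read, link the vertex of smaller rank below the other one; for equal ranks flip a coin and either link the vertex that is smaller in a fixed arbitrary total order of the vertices, or increase the rank of the other one; stop if a link was made. (All outcomes of the coin flips are allowed.) - *UF-Rem-CAS* and *UF-Rem-Lock* (any compress option $F$, splice option SplitAtomicOne or HalveAtomicOne, i.e. not SpliceAtomic): $(a,b)\gets(u,v)$; repeat: read $p_a\gets P[a]$, $p_b\gets P[b]$; leave the loop if $p_a=p_b$; swap names so that $p_a>p_b$. Rem-CAS: if $a=P[a]$ and $\mathrm{CAS}(P[a],a,p_b)$ succeeds, execute $F(u)$, $F(v)$ (unless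 $F$ is FindNaive) and return. Rem-Lock: if $a=P[a]$, lock $a$, read $q\gets P[b]$, and if $a=P[a]$ and $a>q$ write $P[a]\gets q$, unlock and return; if not, unlock and repeat. In Rem-CAS if the test or the CAS fails, and in Rem-Lock if $a\neq P[a]$ at the first test: read $v\gets P[a]$, $w\gets P[v]$, do $\mathrm{CAS}(P[a],v,w)$ if $v\ne w$, set $a\gets v$ (SplitAtomicOne) or $a\gets w$ (HalveAtomicOne), and repeat. When Rem-Lock leaves the loop because $p_a=p_b$, it executes $F(u)$, $F(v)$ (unless $F$ is FindNaive). **(2) Type (2).** Shiloach–Vishkin and the root-based Liu–Tarjan algorithms CRSA, PRSA, PRS, CRFA, PRFA, PRF are correct when batches of edges are inserted one after the other by the algorithm, while arbitrary threads concurrently invoke $\mathrm{Find}$ and $\mathrm{IsConnected}$ (with FindNaive) at arbitrary times, also in the middle of a batch. Here the insertions of the edges of a batch count as separate operations that are all invoked when the batch starts and all return when it ends. The updates are synchronous: in a parallel step, all values are computed from the array $P$ at the beginning of the step, each location is written at most once, and the individual writes become visible to the queries in an arbitrary order. In a round, first every root $h$ that has a candidate $c<h$ gets its smallest candidate as its parent;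 the candidates come from the current edges $\{x,y\}$, where $x$ and $y$ are candidates for each other (CRSA, CRFA), or $P[x]$ and $P[y]$ are candidates for each other (all others). Then $P[v]\gets P[P[v]]$ for all $v$, once (CRSA, PRSA, PRS) or until nothing changes (all others). In the variants with final letter A, the endpoints of the edges are then replaced by their labels. Liu–Tarjan algorithms stop after a round in which neither $P$ nor the edges changed, Shiloach–Vishkin after a round in which no root had a candidate. -/

import Mathlib

namespace ConnectIt

/-! ### Shared memory and programs -/

/-- The shared memory on the vertices `0, …, n-1`.  `parent` is the array of labels (parent
pointers); `hook` is the auxiliary array of hooks (`none` is the initial value `∞`); `locked` is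
the array of mutexes; `rank` is the rank that is stored in the same word as the parent pointer. -/
structure Mem (n : ℕ) where
  parent : Fin n → Fin n
  hook : Fin n → Option (Fin n)
  locked : Fin n → Bool
  rank : Fin n → ℕ

/-- Memory with labels `P₀`, no hooks, no lock held and all ranks `0`. -/
def Mem.start {n : ℕ} (P₀ : Fin n → Fin n) : Mem n where
  parent := P₀
  hook := fun _ => none
  locked := fun _ => false
  rank := fun _ => 0

/-- Programs of a thread that end with a value of type `α`.  Every constructor other than `ret`
and `loop` is one access to shared memory (or one coin flip), followed by a continuation.
`loop body s k` iterates `body` on the local state: `Sum.inl` means that the loop goes on with a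
new local state, `Sum.inr` that it is left with a value, which goes to `k`. -/
inductive Prog (n : ℕ) : Type → Type 1
  | ret {α : Type} (a : α) : Prog n α
  | read {α : Type} (x : Fin n) (k : Fin n → Prog n α) : Prog n α
  | write {α : Type} (x y : Fin n) (k : Prog n α) : Prog n α
  | cas {α : Type} (x old new : Fin n) (k : Bool → Prog n α) : Prog n α
  | casHook {α : Type} (x new : Fin n) (k : Bool → Prog n α) : Prog n α
  | lock {α : Type} (x : Fin n) (k : Prog n α) : Prog n α
  | unlock {α : Type} (x : Fin n) (k : Prog n α) : Prog n α
  | readWord {α : Type} (x : Fin n) (k : Fin n × ℕ → Prog n α) : Prog n α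
  | casWord {α : Type} (x : Fin n) (old new : Fin n × ℕ) (k : Bool → Prog n α) : Prog n α
  | flip {α : Type} (k : Bool → Prog n α) : Prog n α
  | snapshot {α : Type} (k : (Fin n → Fin n) → Prog n α) : Prog n α
  | bulk {α : Type} (W : Fin n → Option (Fin n)) (k : Prog n α) : Prog n α
  | loop {α σ β : Type} (body : σ → Prog n (σ ⊕ β)) (s : σ) (k : β → Prog n α) : Prog n α

namespace Prog

variable {n : ℕ}

/-- Sequential composition. -/
def bind {α β : Type} : Prog n α → (α → Prog n β) → Prog n β
  | ret a, f => f a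
  | read x k, f => read x fun v => bind (k v) f
  | write x y k, f => write x y (bind k f)
  | cas x old new k, f => cas x old new fun b => bind (k b) f
  | casHook x new k, f => casHook x new fun b => bind (k b) f
  | lock x k, f => lock x (bind k f)
  | unlock x k, f => unlock x (bind k f)
  | readWord x k, f => readWord x fun w => bind (k w) f
  | casWord x old new k, f => casWord x old new fun b => bind (k b) f
  | flip k, f => flip fun b => bind (k b) f
  | snapshot k, f => snapshot fun P => bind (k P) f
  | bulk W k, f => bulk W (bind k f)
  | loop body s k, f => loop body s fun b => bind (k b) f

instance : Monad (Prog n) where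
  pure := ret
  bind := bind

end Prog

variable {n : ℕ}

/-- One atomic step of a thread.  `cas` on `parent`, `casHook` on `hook` (with expected value
`∞`) and `casWord` on the pair (parent, rank) are compare-and-swaps.  `flip` has both outcomes.
`bulk W` is a synchronous parallel write of the value `y` to `parent x` for all `x` with
`W x = some y`: each of these locations is written exactly once, and the individual writes become
visible to the other threads one after the other, in an arbitrary order. -/
inductive PStep {α : Type} : Mem n → Prog n α → Mem n → Prog n α → Prop
  | read (m : Mem n) (x : Fin n) (k : Fin n → Prog n α) :
      PStep m (.read x k) m (k (m.parent x))
  | write (m : Mem n) (x y : Fin n) (k : Prog n α) :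
      PStep m (.write x y k) { m with parent := Function.update m.parent x y } k
  | casSuccess (m : Mem n) (x old new : Fin n) (k : Bool → Prog n α) :
      m.parent x = old →
      PStep m (.cas x old new k) { m with parent := Function.update m.parent x new } (k true)
  | casFail (m : Mem n) (x old new : Fin n) (k : Bool → Prog n α) :
      m.parent x ≠ old → PStep m (.cas x old new k) m (k false)
  | casHookSuccess (m : Mem n) (x new : Fin n) (k : Bool → Prog n α) :
      m.hook x = none →
      PStep m (.casHook x new k) { m with hook := Function.update m.hook x (some new) } (k true)
  | casHookFail (m : Mem n) (x new : Fin n) (k : Bool → Prog n α) :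
      m.hook x ≠ none → PStep m (.casHook x new k) m (k false)
  | lock (m : Mem n) (x : Fin n) (k : Prog n α) :
      m.locked x = false →
      PStep m (.lock x k) { m with locked := Function.update m.locked x true } k
  | unlock (m : Mem n) (x : Fin n) (k : Prog n α) :
      PStep m (.unlock x k) { m with locked := Function.update m.locked x false } k
  | readWord (m : Mem n) (x : Fin n) (k : Fin n × ℕ → Prog n α) :
      PStep m (.readWord x k) m (k (m.parent x, m.rank x))
  | casWordSuccess (m : Mem n) (x : Fin n) (old new : Fin n × ℕ) (k : Bool → Prog n α) :
      (m.parent x, m.rank x) = old →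
      PStep m (.casWord x old new k)
        { m with
          parent := Function.update m.parent x new.1
          rank := Function.update m.rank x new.2 } (k true)
  | casWordFail (m : Mem n) (x : Fin n) (old new : Fin n × ℕ) (k : Bool → Prog n α) :
      (m.parent x, m.rank x) ≠ old → PStep m (.casWord x old new k) m (k false)
  | flip (m : Mem n) (b : Bool) (k : Bool → Prog n α) :
      PStep m (.flip k) m (k b)
  | snapshot (m : Mem n) (k : (Fin n → Fin n) → Prog n α) :
      PStep m (.snapshot k) m (k m.parent)
  | bulkWrite (m : Mem n) (W : Fin n → Option (Fin n)) (x y : Fin n) (k : Prog n α) :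
      W x = some y →
      PStep m (.bulk W k) { m with parent := Function.update m.parent x y }
        (.bulk (Function.update W x none) k)
  | bulkDone (m : Mem n) (W : Fin n → Option (Fin n)) (k : Prog n α) :
      (∀ x, W x = none) → PStep m (.bulk W k) m k
  | loop {σ β : Type} (m : Mem n) (body : σ → Prog n (σ ⊕ β)) (s : σ) (k : β → Prog n α) :
      PStep m (.loop body s k) m
        ((body s).bind fun r =>
          match r with
          | .inl s' => .loop body s' k
          | .inr b => k b)

/-! Single commands. -/

def read (x : Fin n) : Prog n (Fin n) := .read x .ret
def write (x y : Fin n) : Prog n Unit := .write x y (.ret ())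
def cas (x old new : Fin n) : Prog n Bool := .cas x old new .ret
def casHook (x new : Fin n) : Prog n Bool := .casHook x new .ret
def lock (x : Fin n) : Prog n Unit := .lock x (.ret ())
def unlock (x : Fin n) : Prog n Unit := .unlock x (.ret ())
def readWord (x : Fin n) : Prog n (Fin n × ℕ) := .readWord x .ret
def casWord (x : Fin n) (old new : Fin n × ℕ) : Prog n Bool := .casWord x old new .ret
def coin : Prog n Bool := .flip .ret
def snapshot : Prog n (Fin n → Fin n) := .snapshot .ret
def bulk (W : Fin n → Option (Fin n)) : Prog n Unit := .bulk W (.ret ())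
def loop {σ β : Type} (s : σ) (body : σ → Prog n (σ ⊕ β)) : Prog n β := .loop body s .ret

/-! ### Find, splice and connectivity queries -/

/-- `FindNaive(u)`: `v ← u; while v ≠ P[v] do v ← P[v]; return v`. -/
def findNaive (u : Fin n) : Prog n (Fin n) :=
  loop u fun v => do
    let p ← read v
    if p = v then return .inr v else return .inl p

/-- `FindAtomicSplit(u)`: path splitting with `CAS`. -/
def findAtomicSplit (u : Fin n) : Prog n (Fin n) :=
  loop u fun u => do
    let v ← read u
    let w ← read v
    if v = w then return .inr v
    else do
      let _ ← cas u v w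
      return .inl v

/-- `FindAtomicHalve(u)`: path halving with `CAS`. -/
def findAtomicHalve (u : Fin n) : Prog n (Fin n) :=
  loop u fun u => do
    let v ← read u
    let w ← read v
    if v = w then return .inr v
    else do
      let _ ← cas u v w
      let u' ← read u
      return .inl u'

/-- `FindCompress(u)`: find the root `r`, then
`while (j ← P[u]) > r do { P[u] ← r; u ← j }` with plain writes. -/
def findCompress (u : Fin n) : Prog n (Fin n) := do
  let p ← read u
  if p = u then return u
  else do
    let r ← findNaive u
    loop u fun u => do
      let j ← read u
      if r < j then do
        write u r
        return .inl j
      else return .inr r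

inductive FindOption
  | naive
  | atomicSplit
  | atomicHalve
  | compress
  deriving DecidableEq

def FindOption.prog : FindOption → Fin n → Prog n (Fin n)
  | naive => findNaive
  | atomicSplit => findAtomicSplit
  | atomicHalve => findAtomicHalve
  | compress => findCompress

/-- `FindTwoTrySplit(u)`: path splitting in which two attempts are made at each vertex. -/
def findTwoTrySplit (u : Fin n) : Prog n (Fin n) :=
  loop u fun u => do
    let v ← read u
    let w ← read v
    if v = w then return .inr v
    else do
      let _ ← cas u v w
      let v' ← read u
      let w' ← read v'
      let _ ← cas u v' w'
      return .inl v'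

/-- The find options of `UF-JTB`. -/
inductive JTBFindOption
  | naive
  | twoTrySplit

def JTBFindOption.prog : JTBFindOption → Fin n → Prog n (Fin n)
  | naive => findNaive
  | twoTrySplit => findTwoTrySplit

/-- The splice options of Rem's algorithms other than `SpliceAtomic`. -/
inductive SpliceOption
  | splitAtomicOne
  | halveAtomicOne

def SpliceOption.prog : SpliceOption → Fin n → Prog n (Fin n)
  | splitAtomicOne, u => do
      let v ← read u
      let w ← read v
      if v = w then return v
      else do
        let _ ← cas u v w
        return v
  | halveAtomicOne, u => do
      let v ← read u
      let w ← read v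
      if v = w then return w
      else do
        let _ ← cas u v w
        return w

/-- `IsConnected(u, v)`: compare the labels (roots) of `u` and `v`; the answer `false` is given
only if the first root is still a root after the second one has been found, and the comparison is
repeated otherwise. -/
def isConnectedProg (find : Fin n → Prog n (Fin n)) (u v : Fin n) : Prog n Bool :=
  loop (u, v) fun s => do
    let a ← find s.1
    let b ← find s.2
    if a = b then return .inr true
    else do
      let p ← read a
      if p = a then return .inr false else return .inl (a, b)

/-! ### Union -/

/-- `UF-Async`. -/
def unionAsync (find : Fin n → Prog n (Fin n)) (u v : Fin n) : Prog n Unit :=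
  loop () fun _ => do
    let a ← find u
    let b ← find v
    if a = b then return .inr ()
    else do
      let hi := max a b
      let lo := min a b
      let p ← read hi
      if p = hi then do
        let ok ← cas hi hi lo
        if ok then return .inr () else return .inl ()
      else return .inl ()

/-- `UF-Hooks`. -/
def unionHooks (find : Fin n → Prog n (Fin n)) (u v : Fin n) : Prog n Unit :=
  loop () fun _ => do
    let a ← find u
    let b ← find v
    if a = b then return .inr ()
    else do
      let hi := max a b
      let lo := min a b
      let p ← read hi
      if p = hi then do
        let ok ← casHook hi lo
        if ok then do
          write hi lo
          return .inr ()
        else return .inl ()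
      else return .inl ()

/-- The loop of `UF-Early`, which walks up from both endpoints together. -/
def earlyLoop (u v : Fin n) : Prog n Unit :=
  loop (u, v) fun s => do
    if s.1 = s.2 then return .inr ()
    else do
      let hi := max s.1 s.2
      let lo := min s.1 s.2
      let p ← read hi
      let ok ← if p = hi then cas hi hi lo else pure false
      if ok then return .inr ()
      else do
        let z ← read hi
        let w ← read z
        let _ ← cas hi z w
        return .inl (w, lo)

/-- Compress the paths of both endpoints, unless the option is `FindNaive`. -/
def compressBoth (f : FindOption) (u v : Fin n) : Prog n Unit :=
  if f = .naive then pure ()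
  else do
    let _ ← f.prog u
    let _ ← f.prog v
    return ()

/-- `UF-Early`. -/
def unionEarly (f : FindOption) (u v : Fin n) : Prog n Unit := do
  earlyLoop u v
  compressBoth f u v

/-- The link step of `UF-JTB`, on two vertices `a ≠ b` that were found as roots: the root of
smaller rank is linked below the other one.  If the ranks are equal, then a coin decides whether
the root that is smaller in the order `π` of the vertices is linked, or the rank of the other one is
increased.  The result tells whether a link was made. -/
def jtbLink (π : Equiv.Perm (Fin n)) (a b : Fin n) : Prog n Bool := do
  let wa ← readWord a
  let wb ← readWord b
  if wa.2 < wb.2 then casWord a (a, wa.2) (b, wa.2)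
  else if wb.2 < wa.2 then casWord b (b, wb.2) (a, wb.2)
  else do
    let lo := if π a < π b then a else b
    let hi := if π a < π b then b else a
    let c ← coin
    if c then casWord lo (lo, wa.2) (hi, wa.2)
    else do
      let _ ← casWord hi (hi, wa.2) (hi, wa.2 + 1)
      return false

/-- `UF-JTB`. -/
def unionJTB (π : Equiv.Perm (Fin n)) (find : Fin n → Prog n (Fin n)) (u v : Fin n) :
    Prog n Unit :=
  loop (u, v) fun s => do
    let a ← find s.1
    let b ← find s.2
    if a = b then return .inr ()
    else do
      let ok ← jtbLink π a b
      if ok then return .inr () else return .inl (a, b)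

/-- `UF-Rem-CAS`.  The parents of the two current vertices are read at the head of the loop; `a`
is the vertex with the larger of the two parents, and `q` is the smaller parent. -/
def unionRemCAS (c : FindOption) (s : SpliceOption) (u v : Fin n) : Prog n Unit :=
  loop (u, v) fun st => do
    let p₁ ← read st.1
    let p₂ ← read st.2
    if p₁ = p₂ then return .inr ()
    else do
      let a := if p₂ < p₁ then st.1 else st.2
      let b := if p₂ < p₁ then st.2 else st.1
      let q := min p₁ p₂
      let p ← read a
      let ok ← if p = a then cas a a q else pure false
      if ok then do
        compressBoth c u v
        return .inr ()
      else do
        let a' ← s.prog a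
        return .inl (a', b)

/-- `UF-Rem-Lock`.  The loop returns `true` if a link was made under the lock of the root. -/
def unionRemLock (c : FindOption) (s : SpliceOption) (u v : Fin n) : Prog n Unit := do
  let linked ← loop (u, v) fun st => do
    let p₁ ← read st.1
    let p₂ ← read st.2
    if p₁ = p₂ then return .inr false
    else do
      let a := if p₂ < p₁ then st.1 else st.2
      let b := if p₂ < p₁ then st.2 else st.1
      let p ← read a
      if p = a then do
        lock a
        let q ← read b
        let p' ← read a
        if p' = a ∧ q < a then do
          write a q
          unlock a
          return .inr true
        else do
          unlock a
          return .inl (a, b)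
      else do
        let a' ← s.prog a
        return .inl (a', b)
  if linked then pure () else compressBoth c u v

/-- The asynchronous union-find algorithms: every union rule with every find option and, for
Rem's algorithms, every splice option other than `SpliceAtomic`. -/
inductive UFAlg (n : ℕ)
  | async (f : FindOption)
  | hooks (f : FindOption)
  | early (f : FindOption)
  | jtb (π : Equiv.Perm (Fin n)) (f : JTBFindOption)
  | remLock (c : FindOption) (s : SpliceOption)
  | remCAS (c : FindOption) (s : SpliceOption)

def UFAlg.find : UFAlg n → Fin n → Prog n (Fin n)
  | async f | hooks f | early f | remLock f _ | remCAS f _ => f.prog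
  | jtb _ f => f.prog

def UFAlg.union : UFAlg n → Fin n → Fin n → Prog n Unit
  | async f => unionAsync f.prog
  | hooks f => unionHooks f.prog
  | early f => unionEarly f
  | jtb π f => unionJTB π f.prog
  | remLock c s => unionRemLock c s
  | remCAS c s => unionRemCAS c s

/-! ### Synchronous batch updates: Shiloach–Vishkin and root-based Liu–Tarjan -/

/-- `c` is a candidate parent for the tree root `h`: it is joined to `h` by a pair of the list
`D`, and it is smaller than `h`. -/
def IsCandidate (P : Fin n → Fin n) (D : List (Fin n × Fin n)) (h c : Fin n) : Prop :=
  ((h, c) ∈ D ∨ (c, h) ∈ D) ∧ P h = h ∧ c < h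

instance (P : Fin n → Fin n) (D : List (Fin n × Fin n)) (h c : Fin n) :
    Decidable (IsCandidate P D h c) :=
  inferInstanceAs (Decidable (_ ∧ _ ∧ _))

/-- The outcome of the simultaneous `writeMin`s of all candidates: every root with a candidate
gets its smallest candidate. -/
def hookTargets (P : Fin n → Fin n) (D : List (Fin n × Fin n)) (h : Fin n) : Option (Fin n) :=
  if hne : (Finset.univ.filter (IsCandidate P D h)).Nonempty then
    some ((Finset.univ.filter (IsCandidate P D h)).min' hne)
  else none

/-- Replace both endpoints of every edge by their labels. -/
def relabel (P : Fin n → Fin n) (E : List (Fin n × Fin n)) : List (Fin n × Fin n) :=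
  E.map fun e => (P e.1, P e.2)

def shortcutTargets (P : Fin n → Fin n) (v : Fin n) : Option (Fin n) :=
  if P (P v) = P v then none else some (P (P v))

/-- `Shortcut`: `P[v] ← P[P[v]]` for all `v` in parallel. -/
def shortcut : Prog n Unit := do
  let P ← snapshot
  bulk (shortcutTargets P)

/-- `FullShortcut`: repeat `Shortcut` until no parent changes. -/
def fullShortcut : Prog n Unit :=
  loop () fun _ => do
    let P ← snapshot
    if ∀ v, P (P v) = P v then return .inr ()
    else do
      bulk (shortcutTargets P)
      return .inl ()

/-- Shiloach–Vishkin on a batch `B`.  In every round, `prev` is the copy of the labels at the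
start of the round.  Every edge `(u, v)` of the batch with `l = min (P[u], P[v])`,
`h = max (P[u], P[v])`, `l ≠ h`, `h = prev[h]` does `writeMin(P[h], l)`, and then all paths are
shortcut.  The algorithm stops after a round without such an edge. -/
def svUpdate (B : List (Fin n × Fin n)) : Prog n Unit :=
  loop () fun _ => do
    let prev ← snapshot
    let W := hookTargets prev (relabel prev B)
    bulk W
    fullShortcut
    if ∀ h, W h = none then return .inr () else return .inl ()

/-- The root-based variants (those with `RootUp`) of the Liu–Tarjan framework. -/
inductive LTVariant
  | crsa
  | prsa
  | prs
  | crfa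
  | prfa
  | prf

/-- `ParentConnect` (instead of `Connect`). -/
def LTVariant.parentConnect : LTVariant → Bool
  | prsa | prs | prfa | prf => true
  | crsa | crfa => false

/-- `FullShortcut` (instead of `Shortcut`). -/
def LTVariant.fullShortcut : LTVariant → Bool
  | crfa | prfa | prf => true
  | crsa | prsa | prs => false

/-- With the phase `Alter`. -/
def LTVariant.alter : LTVariant → Bool
  | crsa | prsa | crfa | prfa => true
  | prs | prf => false

/-- A root-based Liu–Tarjan algorithm on a batch `B`.  A round consists of the connect phase, in
which every vertex that is a tree root at the start of the round takes the smallest of its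
candidates and itself as its parent, the shortcut phase, and possibly the alter phase.  `Connect`
offers each endpoint of an edge as a candidate to the other endpoint; `ParentConnect` offers the
parent of each endpoint as a candidate to the parent of the other endpoint.  Rounds are repeated
until neither the parents nor the edges change. -/
def ltUpdate (a : LTVariant) (B : List (Fin n × Fin n)) : Prog n Unit :=
  loop B fun E => do
    let P ← snapshot
    bulk (hookTargets P (if a.parentConnect then relabel P E else E))
    if a.fullShortcut then ConnectIt.fullShortcut else shortcut
    let Q ← snapshot
    let E' := if a.alter then relabel Q E else E
    if Q = P ∧ E' = E then return .inr () else return .inl E'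

inductive SyncAlg
  | shiloachVishkin
  | liuTarjan (a : LTVariant)

def SyncAlg.update : SyncAlg → List (Fin n × Fin n) → Prog n Unit
  | shiloachVishkin => svUpdate
  | liuTarjan a => ltUpdate a

/-! ### Operations, histories and linearizability -/

inductive Op (n : ℕ)
  | insert (u v : Fin n)
  | find (u : Fin n)
  | isConnected (u v : Fin n)

inductive Ret (n : ℕ)
  | unit
  | label (v : Fin n)
  | bool (b : Bool)

/-- Invocations and responses of operations by the threads in `θ`. -/
inductive Event (θ : Type*) (n : ℕ)
  | inv (t : θ) (o : Op n)
  | res (t : θ) (r : Ret n)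

/-- Give all vertices with label `a` the label `b`. -/
def merge (C : Fin n → Fin n) (a b : Fin n) : Fin n → Fin n :=
  fun x => if C x = a then b else C x

/-- The sequential semantics, on connectivity labelings: `SeqStep C o r C'` says that the operation
`o` on the labeling `C` may return `r` and leave the labeling `C'`.  Inserting an edge whose
endpoints have different labels unites the two trees, under the label of one of them. -/
inductive SeqStep : (Fin n → Fin n) → Op n → Ret n → (Fin n → Fin n) → Prop
  | insertSame (C : Fin n → Fin n) (u v : Fin n) :
      C u = C v → SeqStep C (.insert u v) .unit C
  | insertLeft (C : Fin n → Fin n) (u v : Fin n) :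
      C u ≠ C v → SeqStep C (.insert u v) .unit (merge C (C u) (C v))
  | insertRight (C : Fin n → Fin n) (u v : Fin n) :
      C u ≠ C v → SeqStep C (.insert u v) .unit (merge C (C v) (C u))
  | find (C : Fin n → Fin n) (u : Fin n) :
      SeqStep C (.find u) (.label (C u)) C
  | isConnected (C : Fin n → Fin n) (u v : Fin n) :
      SeqStep C (.isConnected u v) (.bool (decide (C u = C v))) C

/-- Finite executions of a transition system, with the sequence of the labels that they emit. -/
inductive Run {σ : Type*} {ε : Type*} (step : σ → List ε → σ → Prop) : σ → List ε → σ → Prop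
  | nil (s : σ) : Run step s [] s
  | snoc {s s' s'' : σ} {es es' : List ε} :
      Run step s es s' → step s' es' s'' → Run step s (es ++ es') s''

/-- Events of a history into which linearization points have been inserted. -/
inductive LinEvent (θ : Type*) (n : ℕ)
  | ext (e : Event θ n)
  | point (t : θ)

def LinEvent.toEvent {θ : Type*} : LinEvent θ n → Option (Event θ n)
  | ext e => some e
  | point _ => none

/-- The operation of a thread: none, invoked but not yet linearized, or linearized with a result
that is not yet returned. -/
inductive Status (n : ℕ)
  | idle
  | pending (o : Op n)
  | done (r : Ret n)

/-- The operations take effect, one at a time, at their linearization points, each of which lies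
between the invocation and the response of the operation. -/
inductive LinStep {θ : Type*} [DecidableEq θ] :
    (Fin n → Fin n) × (θ → Status n) → List (LinEvent θ n) →
      (Fin n → Fin n) × (θ → Status n) → Prop
  | inv (C : Fin n → Fin n) (st : θ → Status n) (t : θ) (o : Op n) :
      st t = .idle → LinStep (C, st) [.ext (.inv t o)] (C, Function.update st t (.pending o))
  | point (C C' : Fin n → Fin n) (st : θ → Status n) (t : θ) (o : Op n) (r : Ret n) :
      st t = .pending o → SeqStep C o r C' →
      LinStep (C, st) [.point t] (C', Function.update st t (.done r))
  | res (C : Fin n → Fin n) (st : θ → Status n) (t : θ) (r : Ret n) :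
      st t = .done r → LinStep (C, st) [.ext (.res t r)] (C, Function.update st t .idle)

/-- A history is linearizable, from the labeling `C₀`, if linearization points can be inserted
into it such that the operations, applied sequentially at their linearization points, return the
results of the history.  An operation without a response may have a linearization point or not. -/
def Linearizable {θ : Type*} [DecidableEq θ] (C₀ : Fin n → Fin n) (H : List (Event θ n)) : Prop :=
  ∃ (L : List (LinEvent θ n)) (s : (Fin n → Fin n) × (θ → Status n)),
    L.filterMap LinEvent.toEvent = H ∧ Run LinStep (C₀, fun _ => Status.idle) L s

/-! ### Asynchronous executions of a union-find algorithm -/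

def UFAlg.impl (A : UFAlg n) : Op n → Prog n (Ret n)
  | .insert u v => do
      A.union u v
      return .unit
  | .find u => do
      let r ← A.find u
      return .label r
  | .isConnected u v => do
      let b ← isConnectedProg A.find u v
      return .bool b

/-- The memory, and the rest of the program of the current operation of every thread. -/
structure Config (T : Type*) (n : ℕ) where
  mem : Mem n
  thr : T → Option (Prog n (Ret n))

/-- At any time, an idle thread may invoke any operation, and a thread with a current operation
may perform its next atomic step, or return if the program has ended. -/
inductive UFStep {T : Type*} [DecidableEq T] (A : UFAlg n) :
    Config T n → List (Event T n) → Config T n → Prop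
  | invoke (c : Config T n) (t : T) (o : Op n) :
      c.thr t = none →
      UFStep A c [.inv t o] { c with thr := Function.update c.thr t (some (A.impl o)) }
  | step (c : Config T n) (t : T) (p p' : Prog n (Ret n)) (m' : Mem n) :
      c.thr t = some p → PStep c.mem p m' p' →
      UFStep A c [] { mem := m', thr := Function.update c.thr t (some p') }
  | respond (c : Config T n) (t : T) (r : Ret n) :
      c.thr t = some (.ret r) →
      UFStep A c [.res t r] { c with thr := Function.update c.thr t none }

/-- The histories of the algorithm `A`, started with the labels `P₀`. -/
def UFAlg.IsHistory {T : Type*} [DecidableEq T] (A : UFAlg n) (P₀ : Fin n → Fin n)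
    (H : List (Event T n)) : Prop :=
  ∃ c : Config T n, Run (UFStep A) { mem := Mem.start P₀, thr := fun _ => none } H c

/-! ### Asynchronous queries during synchronous batch updates -/

inductive Query (n : ℕ)
  | find (u : Fin n)
  | isConnected (u v : Fin n)

def Query.toOp : Query n → Op n
  | find u => .find u
  | isConnected u v => .isConnected u v

def Query.impl : Query n → Prog n (Ret n)
  | find u => do
      let r ← findNaive u
      return .label r
  | isConnected u v => do
      let b ← isConnectedProg findNaive u v
      return .bool b

/-- The memory, the current queries of the threads, and the current batch with the rest of the
program of its update. -/
structure SyncConfig (T : Type*) (n : ℕ) where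
  mem : Mem n
  thr : T → Option (Prog n (Ret n))
  upd : Option (List (Fin n × Fin n) × Prog n Unit)

/-- The insertions of the edges of a batch are invoked together: the insertion of the edge with
index `i` counts as an operation of the thread `Sum.inr i`. -/
def batchInv {T : Type*} (B : List (Fin n × Fin n)) : List (Event (T ⊕ ℕ) n) :=
  B.zipIdx.map fun e => .inv (.inr e.2) (.insert e.1.1 e.1.2)

/-- All insertions of a batch return when the batch has been processed. -/
def batchRes {T : Type*} (B : List (Fin n × Fin n)) : List (Event (T ⊕ ℕ) n) :=
  (List.range B.length).map fun i => .res (.inr i) .unit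

/-- Batches are processed one after the other.  The threads in `T` may invoke and execute queries
at any time, also while a batch is being processed. -/
inductive SyncStep {T : Type*} [DecidableEq T] (A : SyncAlg) :
    SyncConfig T n → List (Event (T ⊕ ℕ) n) → SyncConfig T n → Prop
  | invoke (c : SyncConfig T n) (t : T) (q : Query n) :
      c.thr t = none →
      SyncStep A c [.inv (.inl t) q.toOp]
        { c with thr := Function.update c.thr t (some q.impl) }
  | step (c : SyncConfig T n) (t : T) (p p' : Prog n (Ret n)) (m' : Mem n) :
      c.thr t = some p → PStep c.mem p m' p' →
      SyncStep A c [] { c with mem := m', thr := Function.update c.thr t (some p') }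
  | respond (c : SyncConfig T n) (t : T) (r : Ret n) :
      c.thr t = some (.ret r) →
      SyncStep A c [.res (.inl t) r] { c with thr := Function.update c.thr t none }
  | batchStart (c : SyncConfig T n) (B : List (Fin n × Fin n)) :
      c.upd = none →
      SyncStep A c (batchInv B) { c with upd := some (B, A.update B) }
  | batchStep (c : SyncConfig T n) (B : List (Fin n × Fin n)) (p p' : Prog n Unit) (m' : Mem n) :
      c.upd = some (B, p) → PStep c.mem p m' p' →
      SyncStep A c [] { c with mem := m', upd := some (B, p') }
  | batchEnd (c : SyncConfig T n) (B : List (Fin n × Fin n)) :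
      c.upd = some (B, .ret ()) →
      SyncStep A c (batchRes B) { c with upd := none }

/-- The histories of queries of the threads in `T` concurrent with batch updates by `A`, started
with the labels `P₀`. -/
def SyncAlg.IsHistory {T : Type*} [DecidableEq T] (A : SyncAlg) (P₀ : Fin n → Fin n)
    (H : List (Event (T ⊕ ℕ) n)) : Prop :=
  ∃ c : SyncConfig T n,
    Run (SyncStep A) { mem := Mem.start P₀, thr := fun _ => none, upd := none } H c

end ConnectIt

namespace ConnectIt

variable {n : ℕ} {θ : Type*}

/-! ### Histories with sets of possible statuses -/

/-! The memory always represents the labeling that sends each vertex to the root of its tree. Path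
compression gives a non-root another vertex of its tree as parent and leaves the labeling alone;
only the link of a root changes it. Hence an insertion that links takes effect at the link, an
insertion that finds its endpoints connected may take effect when it returns (connections are never
lost), and `Find` takes effect at the read that sees a self-parent.

The delicate case is the answer `false` of a connectivity query. It is correct at the moment the
second root `b` is seen, provided that `a` is a root then, but the algorithm confirms this only
later, by reading `P[a] = a` (a non-root never becomes a root again, so the later test speaks about
the earlier time). The proof therefore carries a set of possible statuses for each operation
(`Valid`): at the earlier moment "done with `false`" joins the set while "pending" stays in it, and
the response picks the status that fits.

Cycles cannot arise because parents follow their children in a strict order `Setting.Prec`. For all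
algorithms except `UF-JTB` it is the reversed order of the indices. For `UF-JTB` it is rank, then
the permutation, above a first level that separates initial non-roots from initial roots; it is
stable because ranks change only at roots and only grow.

Concurrency is handled by rely and guarantee. `GState` extends the memory by the labeling, the
statuses and the owners of vertices. A step of one thread must satisfy `Guar`, which implies the
`Rely` of every other thread: connections persist, non-roots stay non-roots, statuses are private,
an owned root stays a root. Ownership justifies the plain writes that link a root: it is acquired by
the compare-and-swap on the hook or by the lock. `Prog.wp` is a weakest precondition for this
discipline, `Prog.wp_step` its soundness. Safety is all that is needed, so loops require invariants
but no termination argument.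

Queries during a batch change neither memory nor labeling, so the update program can be treated as
sequential, with its writes spread out in time. Each hook is the linearization point of one pending
edge between the two trees (`exists_link`), and shortcuts are splices. When the update stops, all
trees are flat and every edge lies in one tree, so the remaining edges can be linearized as they
return. -/

theorem Run.trans {σ ε : Type*} {step : σ → List ε → σ → Prop} {a b c : σ} {l l' : List ε}
    (h : Run step a l b) (h' : Run step b l' c) : Run step a (l ++ l') c := by
  induction h' with
  | nil => simpa using h
  | snoc _ hs ih => rw [← List.append_assoc]; exact .snoc ih hs

theorem Run.single {σ ε : Type*} {step : σ → List ε → σ → Prop} {a b : σ} {l : List ε}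
    (h : step a l b) : Run step a l b := by
  simpa using Run.snoc (.nil a) h

/-- Every choice of statuses from the sets `S t` is reached, together with the labeling `C`, by
inserting linearization points into the history `H`. -/
def Valid [DecidableEq θ] (P₀ : Fin n → Fin n) (H : List (Event θ n)) (C : Fin n → Fin n)
    (S : θ → Set (Status n)) : Prop :=
  (∀ t, (S t).Nonempty) ∧ ∀ st : θ → Status n, (∀ t, st t ∈ S t) →
    ∃ L : List (LinEvent θ n), L.filterMap LinEvent.toEvent = H ∧
      Run LinStep (P₀, fun _ => Status.idle) L (C, st)

namespace Valid

variable [DecidableEq θ] {P₀ C C' : Fin n → Fin n} {H : List (Event θ n)}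
  {S : θ → Set (Status n)} {t : θ} {o : Op n} {r : Ret n}

theorem start : Valid P₀ ([] : List (Event θ n)) P₀ fun _ => {.idle} := by
  refine ⟨fun _ => ⟨_, rfl⟩, fun st hst => ⟨[], rfl, ?_⟩⟩
  have : st = fun _ => Status.idle := funext hst
  rw [this]
  exact .nil _

theorem linearizable (h : Valid P₀ H C S) : Linearizable P₀ H := by
  choose st hst using h.1
  obtain ⟨L, hL, hr⟩ := h.2 st hst
  exact ⟨L, _, hL, hr⟩

/-- Statuses are chosen independently for the threads, so a change at `t` can be checked alone: each
new status of `t` must come from some old one by a fragment of a linearized history, whatever the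
other threads have chosen. -/
theorem extend (h : Valid P₀ H C S) {A : Set (Status n)} (hA : A.Nonempty)
    {E : List (Event θ n)}
    (hstep : ∀ st : θ → Status n, ∀ y ∈ A, ∃ x ∈ S t, ∃ L : List (LinEvent θ n),
      L.filterMap LinEvent.toEvent = E ∧
        Run LinStep (C, Function.update st t x) L (C', Function.update st t y)) :
    Valid P₀ (H ++ E) C' (Function.update S t A) := by
  refine ⟨fun t' => ?_, fun st hst => ?_⟩
  · by_cases e : t' = t
    · subst e; simpa using hA
    · simpa [e] using h.1 t'
  · obtain ⟨x, hx, L, hL, hr⟩ := hstep st (st t) (by simpa using hst t)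
    obtain ⟨L₀, hL₀, hr₀⟩ := h.2 (Function.update st t x) fun t' => by
      by_cases e : t' = t
      · subst e; simpa using hx
      · simpa [e] using hst t'
    refine ⟨L₀ ++ L, by simp [hL₀, hL], hr₀.trans ?_⟩
    simpa using hr

theorem invoke (h : Valid P₀ H C S) (hs : .idle ∈ S t) :
    Valid P₀ (H ++ [.inv t o]) C (Function.update S t {.pending o}) := by
  refine h.extend (Set.singleton_nonempty _) ?_
  rintro st _ rfl
  refine ⟨_, hs, [.ext (.inv t o)], rfl, .single ?_⟩
  simpa using LinStep.inv C (Function.update st t .idle) t o (by simp)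

theorem respond_done (h : Valid P₀ H C S) (hs : .done r ∈ S t) :
    Valid P₀ (H ++ [.res t r]) C (Function.update S t {.idle}) := by
  refine h.extend (Set.singleton_nonempty _) ?_
  rintro st _ rfl
  refine ⟨_, hs, [.ext (.res t r)], rfl, .single ?_⟩
  simpa using LinStep.res C (Function.update st t (.done r)) t r (by simp)

/-- The labeling may change, and it is common to all choices. So all choices must pass through the
point, and the set of `t` collapses to one status. -/
theorem linearize (h : Valid P₀ H C S) (hs : .pending o ∈ S t) (hq : SeqStep C o r C') :
    Valid P₀ H C' (Function.update S t {.done r}) := by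
  rw [← List.append_nil H]
  refine h.extend (Set.singleton_nonempty _) ?_
  rintro st _ rfl
  refine ⟨_, hs, [.point t], rfl, .single ?_⟩
  simpa using LinStep.point C C' (Function.update st t (.pending o)) t o r (by simp) hq

/-- Since the point leaves the labeling alone, histories with and without it end in the same
labeling, and the old choices survive. This postpones the decision whether the operation takes
effect now. -/
theorem addDone (h : Valid P₀ H C S) (hs : .pending o ∈ S t) (hq : SeqStep C o r C) :
    Valid P₀ H C (Function.update S t (insert (.done r) (S t))) := by
  rw [← List.append_nil H]
  refine h.extend ⟨_, Or.inl rfl⟩ ?_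
  rintro st y (rfl | hy)
  · refine ⟨_, hs, [.point t], rfl, .single ?_⟩
    simpa using LinStep.point C C (Function.update st t (.pending o)) t o r (by simp) hq
  · exact ⟨_, hy, [], rfl, .nil _⟩

/-- The statuses allow the result `r`, possibly after a linearization point that does not change
the labeling. -/
def Returns (C : Fin n → Fin n) (A : Set (Status n)) (r : Ret n) : Prop :=
  .done r ∈ A ∨ ∃ o, .pending o ∈ A ∧ SeqStep C o r C

theorem respond (h : Valid P₀ H C S) (hs : Returns C (S t) r) :
    Valid P₀ (H ++ [.res t r]) C (Function.update S t {.idle}) := by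
  obtain hs | ⟨o, ho, hq⟩ := hs
  · exact h.respond_done hs
  · simpa using (h.linearize ho hq).respond_done (t := t) (r := r) (by simp)

end Valid

/-! ### States of the proof: memory, labeling, statuses, owners -/

/-- The way in which roots are protected against concurrent links: only by compare-and-swaps, by
the array of hooks, or by locks. -/
inductive Protection
  | cas
  | hook
  | lock

/-- The initial labels, the order in which parents increase (the rank is compared after `major`
and before `minor`), and the protection of the roots. -/
structure Setting (n : ℕ) where
  init : Fin n → Fin n
  major : Fin n → ℕ
  minor : Fin n → ℕ
  protection : Protection

namespace Setting

variable (K : Setting n)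

/-- The strict order of the vertices, in which parents follow their children. -/
def Prec (m : Mem n) (x y : Fin n) : Prop :=
  K.major x < K.major y ∨ K.major x = K.major y ∧
    (m.rank x < m.rank y ∨ m.rank x = m.rank y ∧ K.minor x < K.minor y)

/-- Owners of vertices agree with the hooks and the locks. -/
def Owned (m : Mem n) (owner : Fin n → Option θ) : Prop :=
  match K.protection with
  | .cas => ∀ x, owner x = none
  | .hook => ∀ x, m.hook x = none → owner x = none ∧ (K.init x = x → m.parent x = x)
  | .lock => ∀ x, m.locked x = false → owner x = none

variable {K} {m : Mem n} {x y z : Fin n}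

theorem Prec.trans (h : K.Prec m x y) (h' : K.Prec m y z) : K.Prec m x z := by
  unfold Prec at *; omega

theorem Prec.irrefl (h : K.Prec m x x) : False := by
  unfold Prec at *; omega

theorem Prec.ne (h : K.Prec m x y) : x ≠ y := by
  rintro rfl; exact h.irrefl

/-- In the uses of this lemma `x` is a non-root, or at least not a root whose rank is being raised;
its rank is then frozen, while that of `y` can only grow. -/
theorem Prec.congr {m' : Mem n} (h : K.Prec m x y) (hx : m'.rank x = m.rank x)
    (hy : m.rank y ≤ m'.rank y) : K.Prec m' x y := by
  unfold Prec at *; omega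

end Setting

/-- A memory with the labeling that it represents, the possible statuses of the operations, and
the owners of vertices. -/
structure GState (K : Setting n) (θ : Type*) where
  mem : Mem n
  label : Fin n → Fin n
  status : θ → Set (Status n)
  owner : Fin n → Option θ
  label_parent : ∀ x, label (mem.parent x) = label x
  label_root : ∀ x, mem.parent x = x → label x = x
  root_label : ∀ x, mem.parent (label x) = label x
  prec_parent : ∀ x, mem.parent x ≠ x → K.Prec mem x (mem.parent x)
  prec_label : ∀ x, label x ≠ x → K.Prec mem x (label x)
  init_root : ∀ x, mem.parent x = x → K.init x = x
  owned : K.Owned mem owner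

namespace GState

variable {K : Setting n}

/-- What a thread may rely on when the other threads take steps. -/
structure Rely (t : θ) (s s' : GState K θ) : Prop where
  conn : ∀ {x y}, s.label x = s.label y → s'.label x = s'.label y
  nonroot : ∀ {x}, s.mem.parent x ≠ x → s'.mem.parent x ≠ x
  status : s'.status t = s.status t
  owner : ∀ x, s'.owner x = some t ↔ s.owner x = some t
  ownerRoot : ∀ {x}, s.owner x = some t → s.mem.parent x = x → s'.mem.parent x = x
  rank : ∀ x, s.mem.rank x ≤ s'.mem.rank x
  rankNonroot : ∀ {x}, s.mem.parent x ≠ x → s'.mem.rank x = s.mem.rank x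

variable {t : θ} {s s' s'' : GState K θ}

theorem Rely.refl (t : θ) (s : GState K θ) : Rely t s s :=
  ⟨id, id, rfl, fun _ => .rfl, fun _ => id, fun _ => le_rfl, fun _ => rfl⟩

theorem Rely.trans (h : Rely t s s') (h' : Rely t s' s'') : Rely t s s'' :=
  ⟨fun e => h'.conn (h.conn e), fun e => h'.nonroot (h.nonroot e), h'.status.trans h.status,
    fun x => (h'.owner x).trans (h.owner x),
    fun o e => h'.ownerRoot ((h.owner _).2 o) (h.ownerRoot o e),
    fun x => (h.rank x).trans (h'.rank x),
    fun e => (h'.rankNonroot (h.nonroot e)).trans (h.rankNonroot e)⟩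

theorem Rely.prec {x y : Fin n} (h : Rely t s s') (hx : s.mem.parent x ≠ x)
    (hp : K.Prec s.mem x y) : K.Prec s'.mem x y :=
  hp.congr (h.rankNonroot hx) (h.rank y)

/-- What a thread guarantees to the other threads. -/
structure Guar [DecidableEq θ] (t : θ) (s s' : GState K θ) : Prop where
  valid : ∀ H, Valid K.init H s.label s.status → Valid K.init H s'.label s'.status
  rely : ∀ t' ≠ t, Rely t' s s'

theorem Guar.refl [DecidableEq θ] (t : θ) (s : GState K θ) : Guar t s s :=
  ⟨fun _ => id, fun t' _ => .refl t' s⟩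

end GState

/-! ### Weakest preconditions -/

namespace Prog

variable {K : Setting n}

/-- The weakest precondition of a program in an environment that takes steps in `R`, if the
program is to take steps in `G`. -/
def wp (R G : GState K θ → GState K θ → Prop) :
    {α : Type} → Prog n α → (α → GState K θ → Prop) → GState K θ → Prop
  | _, .ret a, Φ, s => ∀ s', R s s' → Φ a s'
  -- A read may come with a change of the auxiliary components, since it can be a linearization
  -- point.
  | _, .read x k, Φ, s => ∀ s', R s s' → ∃ s'' : GState K θ,
      s''.mem = s'.mem ∧ G s' s'' ∧ wp R G (k (s'.mem.parent x)) Φ s''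
  | _, .write x y k, Φ, s => ∀ s', R s s' → ∃ s'' : GState K θ,
      s''.mem = { s'.mem with parent := Function.update s'.mem.parent x y } ∧ G s' s'' ∧
        wp R G k Φ s''
  | _, .cas x old new k, Φ, s => ∀ s', R s s' →
      (s'.mem.parent x = old → ∃ s'' : GState K θ,
        s''.mem = { s'.mem with parent := Function.update s'.mem.parent x new } ∧ G s' s'' ∧
          wp R G (k true) Φ s'') ∧
      (s'.mem.parent x ≠ old → wp R G (k false) Φ s')
  | _, .casHook x new k, Φ, s => ∀ s', R s s' →
      (s'.mem.hook x = none → ∃ s'' : GState K θ,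
        s''.mem = { s'.mem with hook := Function.update s'.mem.hook x (some new) } ∧ G s' s'' ∧
          wp R G (k true) Φ s'') ∧
      (s'.mem.hook x ≠ none → wp R G (k false) Φ s')
  | _, .lock x k, Φ, s => ∀ s', R s s' → s'.mem.locked x = false → ∃ s'' : GState K θ,
      s''.mem = { s'.mem with locked := Function.update s'.mem.locked x true } ∧ G s' s'' ∧
        wp R G k Φ s''
  | _, .unlock x k, Φ, s => ∀ s', R s s' → ∃ s'' : GState K θ,
      s''.mem = { s'.mem with locked := Function.update s'.mem.locked x false } ∧ G s' s'' ∧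
        wp R G k Φ s''
  | _, .readWord x k, Φ, s => ∀ s', R s s' →
      wp R G (k (s'.mem.parent x, s'.mem.rank x)) Φ s'
  | _, .casWord x old new k, Φ, s => ∀ s', R s s' →
      ((s'.mem.parent x, s'.mem.rank x) = old → ∃ s'' : GState K θ,
        s''.mem = { s'.mem with
          parent := Function.update s'.mem.parent x new.1
          rank := Function.update s'.mem.rank x new.2 } ∧ G s' s'' ∧ wp R G (k true) Φ s'') ∧
      ((s'.mem.parent x, s'.mem.rank x) ≠ old → wp R G (k false) Φ s')
  | _, .flip k, Φ, s => ∀ s', R s s' → ∀ b, wp R G (k b) Φ s'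
  | _, .snapshot k, Φ, s => ∀ s', R s s' → wp R G (k s'.mem.parent) Φ s'
  -- The invariant speaks about the set of writes that are still to be made, because their order is
  -- arbitrary.
  | _, .bulk W k, Φ, s => ∀ s', R s s' →
      ∃ I : (Fin n → Option (Fin n)) → GState K θ → Prop, I W s' ∧
        ∀ W s, I W s → ∀ s', R s s' →
          (∀ x y, W x = some y → ∃ s'' : GState K θ,
            s''.mem = { s'.mem with parent := Function.update s'.mem.parent x y } ∧ G s' s'' ∧
              I (Function.update W x none) s'') ∧
          ((∀ x, W x = none) → wp R G k Φ s')
  | _, .loop (σ := σ) body i k, Φ, s => ∀ s', R s s' →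
      ∃ I : σ → GState K θ → Prop, I i s' ∧ ∀ i s, I i s →
        wp R G (body i) (fun r s => match r with
          | .inl i' => I i' s
          | .inr b => wp R G (k b) Φ s) s

variable {R G : GState K θ → GState K θ → Prop}

/-- Every clause of `wp` begins with arbitrary steps of the environment, so transitivity absorbs
further ones. -/
theorem wp_stable (htrans : ∀ a b c, R a b → R b c → R a c) {α : Type} {p : Prog n α}
    {Φ : α → GState K θ → Prop} {s s' : GState K θ} (h : p.wp R G Φ s) (hr : R s s') :
    p.wp R G Φ s' := by
  cases p <;> exact fun s'' hr' => h s'' (htrans _ _ _ hr hr')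

theorem wp_mono {α : Type} {p : Prog n α} {Φ Ψ : α → GState K θ → Prop}
    (hΦ : ∀ a s, Φ a s → Ψ a s) {s : GState K θ} (h : p.wp R G Φ s) : p.wp R G Ψ s := by
  induction p generalizing s with
  | ret a => exact fun s' hr => hΦ _ _ (h s' hr)
  | read x k ih =>
    intro s' hr
    obtain ⟨s'', h₁, h₂, h₃⟩ := h s' hr
    exact ⟨s'', h₁, h₂, ih _ hΦ h₃⟩
  | write x y k ih | unlock x k ih =>
    intro s' hr
    obtain ⟨s'', h₁, h₂, h₃⟩ := h s' hr
    exact ⟨s'', h₁, h₂, ih hΦ h₃⟩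
  | lock x k ih =>
    intro s' hr hl
    obtain ⟨s'', h₁, h₂, h₃⟩ := h s' hr hl
    exact ⟨s'', h₁, h₂, ih hΦ h₃⟩
  | cas x old new k ih | casHook x new k ih | casWord x old new k ih =>
    refine fun s' hr => ⟨fun e => ?_, fun e => ih _ hΦ ((h s' hr).2 e)⟩
    obtain ⟨s'', h₁, h₂, h₃⟩ := (h s' hr).1 e
    exact ⟨s'', h₁, h₂, ih _ hΦ h₃⟩
  | readWord x k ih | snapshot k ih => exact fun s' hr => ih _ hΦ (h s' hr)
  | flip k ih => exact fun s' hr b => ih _ hΦ (h s' hr b)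
  | bulk W k ih =>
    intro s' hr
    obtain ⟨I, hI, hs⟩ := h s' hr
    exact ⟨I, hI, fun W s hW s' hr => ⟨(hs W s hW s' hr).1, fun e => ih hΦ ((hs W s hW s' hr).2 e)⟩⟩
  | loop body i k ihb ihk =>
    intro s' hr
    obtain ⟨I, hI, hs⟩ := h s' hr
    refine ⟨I, hI, fun i s hi => ihb i ?_ (hs i s hi)⟩
    rintro (i' | b) s hs
    · exact hs
    · exact ihk b hΦ hs

theorem wp_bind (hrefl : ∀ s, R s s) {α β : Type} {p : Prog n α} {f : α → Prog n β}
    {Φ : β → GState K θ → Prop} {s : GState K θ}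
    (h : p.wp R G (fun a s => (f a).wp R G Φ s) s) : (p.bind f).wp R G Φ s := by
  induction p generalizing s with
  | ret a => exact h s (hrefl s)
  | read x k ih =>
    intro s' hr
    obtain ⟨s'', h₁, h₂, h₃⟩ := h s' hr
    exact ⟨s'', h₁, h₂, ih _ h₃⟩
  | write x y k ih | unlock x k ih =>
    intro s' hr
    obtain ⟨s'', h₁, h₂, h₃⟩ := h s' hr
    exact ⟨s'', h₁, h₂, ih h₃⟩
  | lock x k ih =>
    intro s' hr hl
    obtain ⟨s'', h₁, h₂, h₃⟩ := h s' hr hl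
    exact ⟨s'', h₁, h₂, ih h₃⟩
  | cas x old new k ih | casHook x new k ih | casWord x old new k ih =>
    refine fun s' hr => ⟨fun e => ?_, fun e => ih _ ((h s' hr).2 e)⟩
    obtain ⟨s'', h₁, h₂, h₃⟩ := (h s' hr).1 e
    exact ⟨s'', h₁, h₂, ih _ h₃⟩
  | readWord x k ih | snapshot k ih => exact fun s' hr => ih _ (h s' hr)
  | flip k ih => exact fun s' hr b => ih _ (h s' hr b)
  | bulk W k ih =>
    intro s' hr
    obtain ⟨I, hI, hs⟩ := h s' hr
    exact ⟨I, hI, fun W s hW s' hr => ⟨(hs W s hW s' hr).1, fun e => ih ((hs W s hW s' hr).2 e)⟩⟩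
  | loop body i k _ ihk =>
    intro s' hr
    obtain ⟨I, hI, hs⟩ := h s' hr
    refine ⟨I, hI, fun i s hi => wp_mono ?_ (hs i s hi)⟩
    rintro (i' | b) s hs
    · exact hs
    · exact ihk b hs

/-- The postcondition of a program may be closed under the steps of the environment. -/
theorem wp_closure (htrans : ∀ a b c, R a b → R b c → R a c) {α : Type} {p : Prog n α}
    {Φ : α → GState K θ → Prop} {s : GState K θ} (h : p.wp R G Φ s) :
    p.wp R G (fun a s => ∀ s', R s s' → Φ a s') s := by
  induction p generalizing s with
  | ret a => exact fun s' hr s'' hr' => h s'' (htrans _ _ _ hr hr')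
  | read x k ih =>
    intro s' hr
    obtain ⟨s'', h₁, h₂, h₃⟩ := h s' hr
    exact ⟨s'', h₁, h₂, ih _ h₃⟩
  | write x y k ih | unlock x k ih =>
    intro s' hr
    obtain ⟨s'', h₁, h₂, h₃⟩ := h s' hr
    exact ⟨s'', h₁, h₂, ih h₃⟩
  | lock x k ih =>
    intro s' hr hl
    obtain ⟨s'', h₁, h₂, h₃⟩ := h s' hr hl
    exact ⟨s'', h₁, h₂, ih h₃⟩
  | cas x old new k ih | casHook x new k ih | casWord x old new k ih =>
    refine fun s' hr => ⟨fun e => ?_, fun e => ih _ ((h s' hr).2 e)⟩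
    obtain ⟨s'', h₁, h₂, h₃⟩ := (h s' hr).1 e
    exact ⟨s'', h₁, h₂, ih _ h₃⟩
  | readWord x k ih | snapshot k ih => exact fun s' hr => ih _ (h s' hr)
  | flip k ih => exact fun s' hr b => ih _ (h s' hr b)
  | bulk W k ih =>
    intro s' hr
    obtain ⟨I, hI, hs⟩ := h s' hr
    exact ⟨I, hI, fun W s hW s' hr => ⟨(hs W s hW s' hr).1, fun e => ih ((hs W s hW s' hr).2 e)⟩⟩
  | loop body i k _ ihk =>
    intro s' hr
    obtain ⟨I, hI, hs⟩ := h s' hr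
    refine ⟨I, hI, fun i s hi => wp_mono ?_ (hs i s hi)⟩
    rintro (i' | b) s hs
    · exact hs
    · exact ihk b hs

/-- Soundness of `wp`: an atomic step can be matched by a permitted step of the extended state,
after which the rest of the program still has its precondition. -/
theorem wp_step (hrefl : ∀ s, R s s) (htrans : ∀ a b c, R a b → R b c → R a c)
    (hG : ∀ s, G s s) {α : Type} {p p' : Prog n α}
    {m' : Mem n} {Φ : α → GState K θ → Prop} {s : GState K θ} (h : p.wp R G Φ s)
    (hp : PStep s.mem p m' p') :
    ∃ s' : GState K θ, s'.mem = m' ∧ G s s' ∧ p'.wp R G Φ s' := by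
  generalize hm : s.mem = m at hp
  cases hp with
  | read | write | unlock => subst hm; exact h s (hrefl s)
  | lock _ _ _ e => subst hm; exact h s (hrefl s) e
  | casSuccess _ _ _ _ _ e | casHookSuccess _ _ _ _ e | casWordSuccess _ _ _ _ _ e =>
    subst hm; exact (h s (hrefl s)).1 e
  | casFail _ _ _ _ _ e | casHookFail _ _ _ _ e | casWordFail _ _ _ _ _ e =>
    subst hm; exact ⟨s, rfl, hG s, (h s (hrefl s)).2 e⟩
  | readWord | snapshot => subst hm; exact ⟨s, rfl, hG s, h s (hrefl s)⟩
  | flip _ b => subst hm; exact ⟨s, rfl, hG s, h s (hrefl s) b⟩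
  | bulkWrite _ W x y k e =>
    subst hm
    obtain ⟨I, hI, hs⟩ := h s (hrefl s)
    obtain ⟨s'', h₁, h₂, h₃⟩ := (hs W s hI s (hrefl s)).1 x y e
    -- The remaining writes need an invariant that holds after steps of the environment, so the old
    -- one is replaced by its closure under `R`.
    refine ⟨s'', h₁, h₂, fun s' hr => ⟨fun W s' => ∃ s, I W s ∧ R s s', ⟨_, h₃, hr⟩, ?_⟩⟩
    rintro W s ⟨s₀, hI, hr⟩ s' hr'
    refine ⟨fun x y e => ?_, fun e => (hs W s₀ hI s' (htrans _ _ _ hr hr')).2 e⟩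
    obtain ⟨s'', h₁, h₂, h₃⟩ := (hs W s₀ hI s' (htrans _ _ _ hr hr')).1 x y e
    exact ⟨s'', h₁, h₂, s'', h₃, hrefl _⟩
  | bulkDone _ W k e =>
    subst hm
    obtain ⟨I, hI, hs⟩ := h s (hrefl s)
    exact ⟨s, rfl, hG s, (hs W s hI s (hrefl s)).2 e⟩
  | loop _ body i k =>
    subst hm
    obtain ⟨I, hI, hs⟩ := h s (hrefl s)
    refine ⟨s, rfl, hG s, wp_bind hrefl (wp_mono ?_ (hs i s hI))⟩
    rintro (i' | b) s' h'
    -- The same closure for the next iterations of the unrolled loop.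
    · refine fun s'' hr => ⟨fun i s => ∃ s₀, I i s₀ ∧ R s₀ s, ⟨_, h', hr⟩, ?_⟩
      rintro i s ⟨s₀, hI, hr⟩
      refine wp_mono ?_ (wp_stable htrans (hs i s₀ hI) hr)
      rintro (i' | b) s' h'
      · exact ⟨_, h', hrefl _⟩
      · exact h'
    · exact h'

end Prog
end ConnectIt

namespace ConnectIt

variable {n : ℕ} {θ : Type*} {K : Setting n}

/-! ### Steps of states -/

namespace GState

variable (s : GState K θ)

/-- Change the possible statuses. -/
def setStatus (S : θ → Set (Status n)) : GState K θ := { s with status := S }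

/-- Give a non-root a new parent in its component. -/
def splice (u w : Fin n) (hu : s.mem.parent u ≠ u) (hl : s.label w = s.label u)
    (hp : K.Prec s.mem u w) : GState K θ where
  mem := { s.mem with parent := Function.update s.mem.parent u w }
  label := s.label
  status := s.status
  owner := s.owner
  label_parent x := by
    by_cases e : x = u
    · subst e; simpa using hl
    · simpa [e] using s.label_parent x
  label_root x := by
    by_cases e : x = u
    · subst e; simpa using fun e => absurd e.symm hp.ne
    · simpa [e] using s.label_root x
  root_label x := by
    have : s.label x ≠ u := fun e => hu (e ▸ s.root_label x)
    simpa [this] using s.root_label x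
  prec_parent x := by
    by_cases e : x = u
    · subst e; simp only [Function.update_self]; exact fun _ => hp
    · simp only [ne_eq, e, not_false_eq_true, Function.update_of_ne]; exact s.prec_parent x
  prec_label := s.prec_label
  init_root x := by
    by_cases e : x = u
    · subst e; simpa using fun e => absurd e.symm hp.ne
    · simpa [e] using s.init_root x
  owned := by
    have h := s.owned
    unfold Setting.Owned at *
    cases hK : K.protection <;> simp only [hK] at h ⊢
    · exact h
    · refine fun x hx => ⟨(h x hx).1, fun e => ?_⟩
      have hr := (h x hx).2 e
      have : x ≠ u := fun e => hu (e ▸ hr)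
      simpa [this] using hr
    · exact h

variable {s}

theorem rely_splice (t : θ) {u w : Fin n} (hu : s.mem.parent u ≠ u)
    (hl : s.label w = s.label u) (hp : K.Prec s.mem u w) :
    Rely t s (s.splice u w hu hl hp) where
  conn h := h
  nonroot {x} h := by
    by_cases e : x = u
    · subst e; simpa [splice] using hp.ne.symm
    · simpa [e, splice] using h
  status := rfl
  owner _ := .rfl
  ownerRoot {x} _ h := by
    have : x ≠ u := fun e => hu (e ▸ h)
    simpa [this, splice] using h
  rank _ := le_rfl
  rankNonroot _ := rfl

/-- `w` may replace `v` as a parent. -/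
def CanSplice (s : GState K θ) (v w : Fin n) : Prop :=
  s.label v = s.label w ∧ (v = w ∨ s.mem.parent v ≠ v ∧ K.Prec s.mem v w)

theorem canSplice_parent (s : GState K θ) (v : Fin n) : s.CanSplice v (s.mem.parent v) := by
  refine ⟨(s.label_parent v).symm, ?_⟩
  by_cases e : s.mem.parent v = v
  · exact .inl e.symm
  · exact .inr ⟨e, s.prec_parent v e⟩

/-- A query may take effect at any time. -/
def addDone [DecidableEq θ] (s : GState K θ) (t : θ) (r : Ret n) : GState K θ :=
  s.setStatus (Function.update s.status t (insert (.done r) (s.status t)))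

end GState

open GState

/-- Parents have smaller indices. -/
def Setting.Descending (K : Setting n) : Prop :=
  ∀ x y, y < x → K.major x < K.major y

theorem Setting.Descending.prec_iff (hK : K.Descending) {m : Mem n}
    {x y : Fin n} : K.Prec m x y ↔ y < x := by
  refine ⟨fun h => ?_, fun h => .inl (hK _ _ h)⟩
  by_contra hle
  obtain e | hlt := (not_lt.mp hle).eq_or_lt
  · exact h.ne e
  · exact (h.trans (.inl (hK _ _ hlt))).irrefl

theorem GState.parent_le (hK : K.Descending) (s : GState K θ) (x : Fin n) :
    s.mem.parent x ≤ x := by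
  by_cases e : s.mem.parent x = x
  · exact e.le
  · exact (hK.prec_iff.1 (s.prec_parent x e)).le

theorem GState.label_le (hK : K.Descending) (s : GState K θ) (x : Fin n) :
    s.label x ≤ x := by
  by_cases e : s.label x = x
  · exact e.le
  · exact (hK.prec_iff.1 (s.prec_label x e)).le

/-- The steps of queries are permitted to the thread `t`. -/
structure QueryGuar [DecidableEq θ] (t : θ) (G : GState K θ → GState K θ → Prop) : Prop where
  refl : ∀ s, G s s
  addDone : ∀ s o r, .pending o ∈ s.status t → SeqStep s.label o r s.label →
    G s (s.addDone t r)

/-- Splices are permitted. -/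
structure SpliceGuar (G : GState K θ → GState K θ → Prop) : Prop where
  refl : ∀ s, G s s
  splice : ∀ s u w hu hl hp, G s (s.splice u w hu hl hp)

/-! ### Proof rules for one thread, and the specifications of `Find` and of queries. -/

namespace Prog

variable {t : θ} {G : GState K θ → GState K θ → Prop} {s : GState K θ}

/-- The weakest precondition for the thread `t`. -/
abbrev wpt (t : θ) (G : GState K θ → GState K θ → Prop) {α : Type} (p : Prog n α)
    (Φ : α → GState K θ → Prop) (s : GState K θ) : Prop := p.wp (Rely t) G Φ s

variable {α β : Type} {Φ : α → GState K θ → Prop}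

theorem wpt_stable {p : Prog n α} {s' : GState K θ} (h : p.wpt t G Φ s) (hr : Rely t s s') :
    p.wpt t G Φ s' :=
  wp_stable (fun _ _ _ => Rely.trans) h hr

theorem wpt_pure {a : α} (h : ∀ s', Rely t s s' → Φ a s') : (pure a : Prog n α).wpt t G Φ s := h

theorem wpt_bind {p : Prog n β} {f : β → Prog n α}
    (h : p.wpt t G (fun b s => (f b).wpt t G Φ s) s) : (p >>= f).wpt t G Φ s :=
  wp_bind (Rely.refl t) h

theorem wpt_pure_bind {a : β} {f : β → Prog n α} (h : (f a).wpt t G Φ s) :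
    ((pure a : Prog n β) >>= f).wpt t G Φ s := h

theorem wpt_read_ghost {x : Fin n} {f : Fin n → Prog n α}
    (h : ∀ s', Rely t s s' → ∃ s'' : GState K θ, s''.mem = s'.mem ∧ G s' s'' ∧
      (f (s'.mem.parent x)).wpt t G Φ s'') : (ConnectIt.read x >>= f).wpt t G Φ s := h

theorem wpt_read (hG : ∀ s, G s s) {x : Fin n} {f : Fin n → Prog n α}
    (h : ∀ s', Rely t s s' → (f (s'.mem.parent x)).wpt t G Φ s') :
    (ConnectIt.read x >>= f).wpt t G Φ s :=
  wpt_read_ghost fun s' hr => ⟨s', rfl, hG s', h s' hr⟩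

/-- The invariant need not be stable under the other threads: its closure under `Rely` serves as the
actual invariant. -/
theorem wpt_loop {σ : Type} {i : σ} {body : σ → Prog n (σ ⊕ α)} (I : σ → GState K θ → Prop)
    (hi : I i s) (hb : ∀ i s, I i s → (body i).wpt t G
      (fun r s => match r with | .inl i => I i s | .inr b => Φ b s) s) :
    (ConnectIt.loop i body).wpt t G Φ s := by
  refine fun s' hr => ⟨fun i s => ∃ s₀, I i s₀ ∧ Rely t s₀ s, ⟨_, hi, hr⟩, ?_⟩
  rintro i s ⟨s₀, hI, hr⟩
  refine wp_mono ?_ (wpt_stable (wp_closure (fun _ _ _ => Rely.trans) (hb i s₀ hI)) hr)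
  rintro (i' | b) s' h'
  · exact ⟨_, h' _ (.refl t s'), .refl t s'⟩
  · exact h'

/-- If `v = w`, a success rewrites the value that is there. Otherwise `v` is a non-root and stays
one; a success with `P[u] = v` shows that `u` is a non-root too (else `u = v` would be a root), and
`u` precedes `v`, which precedes `w`. -/
theorem wpt_cas (hG : SpliceGuar G) {u v w : Fin n} {f : Bool → Prog n α}
    (hc : s.CanSplice v w) (h : ∀ b, (f b).wpt t G Φ s) :
    (ConnectIt.cas u v w >>= f).wpt t G Φ s := by
  refine fun s' hr => ⟨fun e => ?_, fun _ => wpt_stable (h false) hr⟩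
  obtain ⟨hl, rfl | ⟨hv, hp⟩⟩ := hc
  · refine ⟨s', ?_, hG.refl s', wpt_stable (h true) hr⟩
    rw [← e, Function.update_eq_self]
  · have hv' := hr.nonroot hv
    have hu : s'.mem.parent u ≠ u := fun e' => hv' (by rw [← e, e', e'])
    have hl' : s'.label w = s'.label u := by rw [← hr.conn hl, ← e, s'.label_parent]
    have hp' : K.Prec s'.mem u w :=
      (s'.prec_parent u hu).trans (e ▸ hr.prec hv hp)
    exact ⟨s'.splice u w hu hl' hp', rfl, hG.splice .., wpt_stable (h true)
      (hr.trans (rely_splice t hu hl' hp'))⟩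

/-- A plain write needs no test of the old value: the three hypotheses persist under `Rely`, so
whatever parent is overwritten, the write is a splice. -/
theorem wpt_write (hG : SpliceGuar G) {u w : Fin n} {f : Unit → Prog n α}
    (hu : s.mem.parent u ≠ u) (hl : s.label w = s.label u) (hp : K.Prec s.mem u w)
    (h : (f ()).wpt t G Φ s) :
    (ConnectIt.write u w >>= f).wpt t G Φ s := by
  intro s' hr
  exact ⟨s'.splice u w (hr.nonroot hu) (hr.conn hl) (hr.prec hu hp), rfl, hG.splice ..,
    wpt_stable h (hr.trans (rely_splice t _ _ _))⟩

/-- The specification of `Find`: there is a time at which its result is the label of the vertex.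
At this time, the statuses may be changed. -/
def FindSpec (t : θ) (G : GState K θ → GState K θ → Prop) (find : Fin n → Prog n (Fin n)) : Prop :=
  ∀ (u : Fin n) (Φ : Fin n → GState K θ → Prop) (s : GState K θ),
    (∀ r s', Rely t s s' → s'.mem.parent r = r → s'.label u = r →
      ∃ s'' : GState K θ, s''.mem = s'.mem ∧ s''.label = s'.label ∧ G s' s'' ∧
        ∀ s₃, Rely t s'' s₃ → Φ r s₃) →
    (find u).wpt t G Φ s

/-- The walk stays in the component of `u`. The read that finds `v` to be its own parent shows at
this instant that `v` is the label of `u`; this is where the statuses may change. -/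
theorem findNaive_spec (hG : ∀ s, G s s) : FindSpec t G findNaive := by
  intro u Φ s h
  refine wpt_loop (fun v s₁ => Rely t s s₁ ∧ s₁.label v = s₁.label u) ⟨.refl t s, rfl⟩ ?_
  rintro v s₁ ⟨r₁, h₁⟩
  refine wpt_read_ghost fun s₂ r₂ => ?_
  have h₂ := r₂.conn h₁
  by_cases e : s₂.mem.parent v = v
  · obtain ⟨s₃, hm, -, hg, h₃⟩ := h v s₂ (r₁.trans r₂) e (by rw [← h₂, s₂.label_root v e])
    refine ⟨s₃, hm, hg, ?_⟩
    rw [if_pos e]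
    exact wpt_pure fun s₄ r₄ => h₃ s₄ r₄
  · refine ⟨s₂, rfl, hG s₂, ?_⟩
    rw [if_neg e]
    exact wpt_pure fun s₃ r₃ => ⟨(r₁.trans r₂).trans r₃, r₃.conn (by rw [s₂.label_parent, h₂])⟩

theorem findAtomicSplit_spec (hG : SpliceGuar G) : FindSpec t G findAtomicSplit := by
  intro u Φ s h
  refine wpt_loop (fun v s₁ => Rely t s s₁ ∧ s₁.label v = s₁.label u) ⟨.refl t s, rfl⟩ ?_
  rintro x s₁ ⟨r₁, h₁⟩
  refine wpt_read hG.refl fun s₂ r₂ => wpt_read_ghost fun s₃ r₃ => ?_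
  generalize hv : s₂.mem.parent x = v
  have h₃ : s₃.label v = s₃.label u :=
    r₃.conn (by rw [← hv, s₂.label_parent]; exact r₂.conn h₁)
  by_cases e : s₃.mem.parent v = v
  · obtain ⟨s₄, hm, -, hg, h₄⟩ := h v s₃ ((r₁.trans r₂).trans r₃) e
      (by rw [← h₃, s₃.label_root v e])
    refine ⟨s₄, hm, hg, ?_⟩
    rw [if_pos e.symm]
    exact wpt_pure h₄
  · refine ⟨s₃, rfl, hG.refl s₃, ?_⟩
    rw [if_neg (Ne.symm e)]
    exact wpt_cas hG (s₃.canSplice_parent v) fun _ => wpt_pure fun s₄ r₄ =>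
      ⟨((r₁.trans r₂).trans r₃).trans r₄, r₄.conn h₃⟩

theorem findAtomicHalve_spec (hG : SpliceGuar G) : FindSpec t G findAtomicHalve := by
  intro u Φ s h
  refine wpt_loop (fun v s₁ => Rely t s s₁ ∧ s₁.label v = s₁.label u) ⟨.refl t s, rfl⟩ ?_
  rintro x s₁ ⟨r₁, h₁⟩
  refine wpt_read hG.refl fun s₂ r₂ => wpt_read_ghost fun s₃ r₃ => ?_
  generalize hv : s₂.mem.parent x = v
  have h₃ : s₃.label v = s₃.label u :=
    r₃.conn (by rw [← hv, s₂.label_parent]; exact r₂.conn h₁)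
  by_cases e : s₃.mem.parent v = v
  · obtain ⟨s₄, hm, -, hg, h₄⟩ := h v s₃ ((r₁.trans r₂).trans r₃) e
      (by rw [← h₃, s₃.label_root v e])
    refine ⟨s₄, hm, hg, ?_⟩
    rw [if_pos e.symm]
    exact wpt_pure h₄
  · refine ⟨s₃, rfl, hG.refl s₃, ?_⟩
    rw [if_neg (Ne.symm e)]
    refine wpt_cas hG (s₃.canSplice_parent v) fun _ => wpt_read hG.refl fun s₄ r₄ =>
      wpt_pure fun s₅ r₅ => ⟨(((r₁.trans r₂).trans r₃).trans r₄).trans r₅, r₅.conn ?_⟩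
    rw [s₄.label_parent]
    exact ((r₂.trans r₃).trans r₄).conn h₁

theorem findTwoTrySplit_spec (hG : SpliceGuar G) : FindSpec t G findTwoTrySplit := by
  intro u Φ s h
  refine wpt_loop (fun v s₁ => Rely t s s₁ ∧ s₁.label v = s₁.label u) ⟨.refl t s, rfl⟩ ?_
  rintro x s₁ ⟨r₁, h₁⟩
  refine wpt_read hG.refl fun s₂ r₂ => wpt_read_ghost fun s₃ r₃ => ?_
  generalize hv : s₂.mem.parent x = v
  have h₃ : s₃.label v = s₃.label u :=
    r₃.conn (by rw [← hv, s₂.label_parent]; exact r₂.conn h₁)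
  by_cases e : s₃.mem.parent v = v
  · obtain ⟨s₄, hm, -, hg, h₄⟩ := h v s₃ ((r₁.trans r₂).trans r₃) e
      (by rw [← h₃, s₃.label_root v e])
    refine ⟨s₄, hm, hg, ?_⟩
    rw [if_pos e.symm]
    exact wpt_pure h₄
  · refine ⟨s₃, rfl, hG.refl s₃, ?_⟩
    rw [if_neg (Ne.symm e)]
    refine wpt_cas hG (s₃.canSplice_parent v) fun _ => wpt_read hG.refl fun s₄ r₄ =>
      wpt_read hG.refl fun s₅ r₅ => wpt_cas hG (s₅.canSplice_parent _) fun _ =>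
      wpt_pure fun s₆ r₆ => ⟨((((r₁.trans r₂).trans r₃).trans r₄).trans r₅).trans r₆,
        (r₅.trans r₆).conn ?_⟩
    rw [s₄.label_parent]
    exact ((r₂.trans r₃).trans r₄).conn h₁

/-- The linearization point is the read that discovers the root. In the compression `r` may already
have been linked elsewhere; only the facts that `r` is in the tree of the current vertex and is
smaller than its parent matter. -/
theorem findCompress_spec (hK : K.Descending) (hG : SpliceGuar G) :
    FindSpec t G findCompress := by
  intro u Φ s h
  refine wpt_read_ghost fun s₁ r₁ => ?_
  by_cases e : s₁.mem.parent u = u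
  · obtain ⟨s₂, hm, -, hg, h₂⟩ := h u s₁ r₁ e (s₁.label_root u e)
    refine ⟨s₂, hm, hg, ?_⟩
    rw [if_pos e]
    exact wpt_pure h₂
  refine ⟨s₁, rfl, hG.refl s₁, ?_⟩
  rw [if_neg e]
  refine wpt_bind (findNaive_spec hG.refl u _ s₁ fun r s₂ r₂ hr hu => ?_)
  obtain ⟨s₃, hm, hl, hg, h₃⟩ := h r s₂ (r₁.trans r₂) hr hu
  refine ⟨s₃, hm, hl, hg, fun s₄ r₄ => ?_⟩
  refine wpt_loop (fun x s₅ => Rely t s₃ s₅ ∧ s₅.label r = s₅.label x)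
    ⟨r₄, r₄.conn (by rw [hl, hu, s₂.label_root r hr])⟩ ?_
  rintro x s₅ ⟨r₅, h₅⟩
  refine wpt_read hG.refl fun s₆ r₆ => ?_
  have h₆ := r₆.conn h₅
  have hle := s₆.parent_le hK x
  split_ifs with hlt
  -- If `x` were a root, it would be the label of `r`, so `x ≤ r`, against `r < P[x] ≤ x`.
  · have hx : s₆.mem.parent x ≠ x := fun e => by
      have := s₆.label_le hK r
      rw [h₆, s₆.label_root x e] at this
      omega
    refine wpt_write hG hx h₆ (hK.prec_iff.2 (by omega)) (wpt_pure fun s₇ r₇ =>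
      ⟨(r₅.trans r₆).trans r₇, r₇.conn ?_⟩)
    rw [s₆.label_parent, h₆]
  · exact wpt_pure fun s₇ r₇ => h₃ s₇ ((r₅.trans r₆).trans r₇)

theorem findOption_spec (hK : K.Descending) (hG : SpliceGuar G) (f : FindOption) :
    FindSpec t G f.prog := by
  cases f
  · exact findNaive_spec hG.refl
  · exact findAtomicSplit_spec hG
  · exact findAtomicHalve_spec hG
  · exact findCompress_spec hK hG

theorem jtbFindOption_spec (hG : SpliceGuar G) (f : JTBFindOption) : FindSpec t G f.prog := by
  cases f
  · exact findNaive_spec hG.refl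
  · exact findTwoTrySplit_spec hG

/-- `Find` without a change of the statuses. -/
theorem FindSpec.wpt {find : Fin n → Prog n (Fin n)} (hf : FindSpec t G find)
    (hG : ∀ s, G s s) {u : Fin n} {Φ : Fin n → GState K θ → Prop}
    (h : ∀ r s', Rely t s s' → s'.label u = s'.label r → K.init r = r → Φ r s') :
    (find u).wpt t G Φ s :=
  hf u Φ s fun r s₁ r₁ hr hl => ⟨s₁, rfl, rfl, hG s₁, fun s₂ r₂ =>
    h r s₂ (r₁.trans r₂) (r₂.conn (by rw [hl, s₁.label_root r hr])) (s₁.init_root r hr)⟩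

/-- The postcondition of an operation. -/
def Final (t : θ) (r : Ret n) (s : GState K θ) : Prop :=
  Valid.Returns s.label (s.status t) r

variable [DecidableEq θ]

theorem find_impl {find : Fin n → Prog n (Fin n)} (hf : FindSpec t G find)
    (hG : QueryGuar t G) {u : Fin n} (hs : .pending (.find u) ∈ s.status t) :
    (do let r ← find u; return .label r : Prog n (Ret n)).wpt t G (Final t) s := by
  refine wpt_bind (hf u _ s fun r s₁ r₁ _ hl => ?_)
  refine ⟨s₁.addDone t (.label r), rfl, rfl, hG.addDone s₁ (.find u) _ (by rwa [r₁.status])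
    (hl ▸ .find s₁.label u), fun s₂ r₂ => wpt_pure fun s₃ r₃ => .inl ?_⟩
  rw [r₃.status, r₂.status]
  simp [addDone, setStatus]

/-- The answer `true` takes effect at the response, when both vertices still have a common label.
The answer `false` is offered as a possibility at the read that finds the root `b`; the pending
status is kept in case the later test of `a` fails. Offers from earlier iterations do no harm. -/
theorem isConnected_impl {find : Fin n → Prog n (Fin n)} (hf : FindSpec t G find)
    (hG : QueryGuar t G) {u v : Fin n} (hs : .pending (.isConnected u v) ∈ s.status t) :
    (do let b ← isConnectedProg find u v; return .bool b : Prog n (Ret n)).wpt t G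
      (Final t) s := by
  refine wpt_bind (wpt_loop (fun x s => .pending (.isConnected u v) ∈ s.status t ∧
    s.label x.1 = s.label u ∧ s.label x.2 = s.label v) ⟨hs, rfl, rfl⟩ ?_)
  rintro ⟨x, y⟩ s ⟨hs, hx, hy⟩
  dsimp only at hx hy ⊢
  refine wpt_bind (hf.wpt hG.refl fun a s₁ r₁ ha _ => ?_)
  refine wpt_bind (hf y _ s₁ fun b s₂ r₂ hb hl => ?_)
  have hx₂ := (r₁.trans r₂).conn hx
  have hy₂ := (r₁.trans r₂).conn hy
  have ha₂ := r₂.conn ha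
  have hs₂ : .pending (.isConnected u v) ∈ s₂.status t := by rwa [r₂.status, r₁.status]
  have hbl := s₂.label_root b hb
  -- At the instant when `b` is a root, either `a` is a different root, and `false` is a correct
  -- answer now, or `a = b`, or `a` is a non-root and the later test must fail.
  have key : ∃ s₃ : GState K θ, s₃.mem = s₂.mem ∧ s₃.label = s₂.label ∧ G s₂ s₃ ∧
      .pending (.isConnected u v) ∈ s₃.status t ∧
      (a = b ∨ .done (.bool false) ∈ s₃.status t ∨ s₃.mem.parent a ≠ a) := by
    by_cases e : a = b ∨ s₂.mem.parent a ≠ a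
    · exact ⟨s₂, rfl, rfl, hG.refl _, hs₂, by tauto⟩
    · push Not at e
      refine ⟨s₂.addDone t (.bool false), rfl, rfl, hG.addDone _ _ _ hs₂ ?_, ?_, ?_⟩
      · have : (false : Bool) = decide (s₂.label u = s₂.label v) := by
          rw [← hx₂, ← hy₂, ha₂, hl, s₂.label_root a e.2]
          simp [e.1]
        rw [this]
        exact .isConnected ..
      · simp [addDone, setStatus, hs₂]
      · simp [addDone, setStatus]
  obtain ⟨s₃, hm, hl₃, hg, hs₃, h₃⟩ := key
  refine ⟨s₃, hm, hl₃, hg, fun s₄ r₄ => ?_⟩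
  have hs₄ : .pending (.isConnected u v) ∈ s₄.status t := by rwa [r₄.status]
  have hau₄ : s₄.label a = s₄.label u := r₄.conn (by rw [hl₃, ← ha₂, hx₂])
  have hbv₄ : s₄.label b = s₄.label v := r₄.conn (by rw [hl₃, hbl, ← hl, hy₂])
  have h₄ : a = b ∨ .done (.bool false) ∈ s₄.status t ∨ s₄.mem.parent a ≠ a := by
    rw [r₄.status]
    exact h₃.imp_right (Or.imp_right r₄.nonroot)
  split_ifs with hab
  · refine wpt_pure fun s₅ r₅ => wpt_pure fun s₆ r₆ => .inr ⟨.isConnected u v, ?_, ?_⟩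
    · rwa [r₆.status, r₅.status]
    · have : true = decide (s₆.label u = s₆.label v) := by
        rw [← (r₅.trans r₆).conn hau₄, ← (r₅.trans r₆).conn hbv₄, hab]; simp
      rw [this]
      exact .isConnected ..
  · refine wpt_read hG.refl fun s₅ r₅ => ?_
    split_ifs with hp
    · refine wpt_pure fun s₆ r₆ => wpt_pure fun s₇ r₇ => .inl ?_
      rw [r₇.status, r₆.status, r₅.status]
      obtain h | h | h := h₄
      · exact absurd h hab
      · exact h
      · exact absurd hp (r₅.nonroot h)
    · refine wpt_pure fun s₆ r₆ => ⟨?_, (r₅.trans r₆).conn hau₄, (r₅.trans r₆).conn hbv₄⟩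
      rwa [r₆.status, r₅.status]

end Prog
end ConnectIt

namespace ConnectIt

variable {n : ℕ} {θ : Type*} {K : Setting n}

namespace GState

/-! ### Links, ownership and ranks -/

/-- A link below a vertex that follows `h` closes no cycle: the root of `l` is `l` or follows it, so
it follows `h` as well. -/
theorem label_ne_of_prec (s : GState K θ) {h l : Fin n} (hp : K.Prec s.mem h l) :
    s.label l ≠ h := fun e => by
  by_cases e' : s.label l = l
  · exact hp.ne (e ▸ e')
  · exact (hp.trans (e ▸ s.prec_label l e')).irrefl

/-- Link the root `h` below `l`. -/
def link (s : GState K θ) (h l : Fin n) (S : θ → Set (Status n)) (hr : s.mem.parent h = h)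
    (hp : K.Prec s.mem h l) (hh : K.protection = .hook → s.mem.hook h ≠ none) : GState K θ where
  mem := { s.mem with parent := Function.update s.mem.parent h l }
  -- The vertex `l` need not be a root, so the merged tree gets the label of `l`.
  label := merge s.label h (s.label l)
  status := S
  owner := s.owner
  label_parent x := by
    by_cases e : x = h
    · subst e
      simp [merge, s.label_ne_of_prec hp, s.label_root x hr]
    · simp [e, merge, s.label_parent]
  label_root x := by
    by_cases e : x = h
    · subst e; simpa using fun e => absurd e.symm hp.ne
    · intro hx
      simp only [ne_eq, e, not_false_eq_true, Function.update_of_ne] at hx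
      simp [merge, s.label_root x hx, e]
  root_label x := by
    by_cases e : s.label x = h
    · simp [merge, e, s.label_ne_of_prec hp, s.root_label]
    · simp [merge, e, s.root_label]
  prec_parent x := by
    by_cases e : x = h
    · subst e; simp only [Function.update_self]; exact fun _ => hp
    · simp only [ne_eq, e, not_false_eq_true, Function.update_of_ne]; exact s.prec_parent x
  prec_label x := by
    intro hx
    have hl : K.Prec s.mem h (s.label l) := by
      by_cases e' : s.label l = l
      · rwa [e']
      · exact hp.trans (s.prec_label l e')
    by_cases e : s.label x = h
    · simp only [merge, if_pos e]
      by_cases e' : x = h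
      · subst e'; exact hl
      · exact Setting.Prec.trans (e ▸ s.prec_label x (e ▸ Ne.symm e')) hl
    · simp only [merge, if_neg e] at hx ⊢
      exact s.prec_label x hx
  init_root x := by
    by_cases e : x = h
    · subst e; simpa using fun e => absurd e.symm hp.ne
    · simpa [e] using s.init_root x
  owned := by
    have ho := s.owned
    unfold Setting.Owned at *
    cases hK : K.protection <;> simp only [hK] at ho ⊢
    · exact ho
    · intro x hx
      -- With hooks, a free hook certifies an unlinked vertex; the hook of `h` is taken, so the link
      -- leaves these certificates intact.
      have : x ≠ h := fun e => hh hK (e ▸ hx)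
      simpa [this] using ho x hx
    · exact ho

/-- An owner relies on its root staying a root, so no thread other than the linking one may own `h`.
-/
theorem rely_link {s : GState K θ} {h l : Fin n} {S : θ → Set (Status n)} {hr hp hh} {t : θ}
    (hS : S t = s.status t) (ho : s.owner h ≠ some t) : Rely t s (s.link h l S hr hp hh) where
  conn {x y} e := by simp [link, merge, e]
  nonroot {x} e := by
    have : x ≠ h := fun e' => e (e' ▸ hr)
    simpa [link, this] using e
  status := hS
  owner _ := .rfl
  ownerRoot {x} e e' := by
    have : x ≠ h := fun e' => ho (e' ▸ e)
    simpa [link, this] using e'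
  rank _ := le_rfl
  rankNonroot _ := rfl

/-- Change hooks, locks and owners. -/
def setOwner (s : GState K θ) (hook : Fin n → Option (Fin n)) (locked : Fin n → Bool)
    (owner : Fin n → Option θ)
    (ho : K.Owned { s.mem with hook := hook, locked := locked } owner) : GState K θ :=
  { s with mem := { s.mem with hook := hook, locked := locked }, owner := owner, owned := ho }

/-- Increase the rank of the root `h`. -/
def rankUp (s : GState K θ) (h : Fin n) (hr : s.mem.parent h = h) : GState K θ :=
  -- A larger rank can only spoil comparisons with `h` on the left; none are required, as `h` is a
  -- root.
  have key : ∀ x y, x ≠ h → K.Prec s.mem x y →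
      K.Prec { s.mem with rank := Function.update s.mem.rank h (s.mem.rank h + 1) } x y :=
    fun x y hx hp => hp.congr (by simp [hx]) (by
      by_cases e : y = h
      · subst e; simp
      · simp [e])
  { s with
    mem := { s.mem with rank := Function.update s.mem.rank h (s.mem.rank h + 1) }
    prec_parent := fun x hx => key _ _ (fun e => hx (e ▸ hr)) (s.prec_parent x hx)
    prec_label := fun x hx => key _ _ (fun e => hx (e ▸ s.label_root h hr)) (s.prec_label x hx)
    owned := s.owned }

theorem rely_rankUp (s : GState K θ) {h : Fin n} (hr : s.mem.parent h = h) (t : θ) :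
    Rely t s (s.rankUp h hr) where
  conn := id
  nonroot := id
  status := rfl
  owner _ := .rfl
  ownerRoot _ := id
  rank x := by
    by_cases e : x = h
    · subst e; simp [rankUp]
    · simp [rankUp, e]
  rankNonroot {x} hx := by
    have : x ≠ h := fun e => hx (e ▸ hr)
    simp [rankUp, this]

/-- The insertion of `{u, v}` is pending, and `x`, `y` are in the trees of `u` and `v`. -/
def Joins (s : GState K θ) (t : θ) (u v x y : Fin n) : Prop :=
  .pending (.insert u v) ∈ s.status t ∧
    (s.label u = s.label x ∧ s.label v = s.label y ∨ s.label u = s.label y ∧ s.label v = s.label x)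

/-- The insertion of `{u, v}` may return. -/
def Inserted (s : GState K θ) (t : θ) (u v : Fin n) : Prop :=
  .done .unit ∈ s.status t ∨ .pending (.insert u v) ∈ s.status t ∧ s.label u = s.label v

variable {t : θ} {s s' : GState K θ} {u v x y x' : Fin n}

theorem Joins.mono (h : s.Joins t u v x y) (hs : s'.status t = s.status t)
    (hl : ∀ x y, s.label x = s.label y → s'.label x = s'.label y) : s'.Joins t u v x y :=
  ⟨hs ▸ h.1, h.2.imp (fun h => ⟨hl _ _ h.1, hl _ _ h.2⟩) fun h => ⟨hl _ _ h.1, hl _ _ h.2⟩⟩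

theorem Joins.rely (h : s.Joins t u v x y) (r : Rely t s s') : s'.Joins t u v x y :=
  h.mono r.status fun _ _ => r.conn

theorem Joins.self (hs : .pending (.insert u v) ∈ s.status t) : s.Joins t u v u v :=
  ⟨hs, .inl ⟨rfl, rfl⟩⟩

theorem Joins.symm (h : s.Joins t u v x y) : s.Joins t u v y x := ⟨h.1, h.2.symm⟩

theorem Joins.congr_left (h : s.Joins t u v x y) (e : s.label x = s.label x') :
    s.Joins t u v x' y := ⟨h.1, by rw [← e]; exact h.2⟩

theorem Joins.congr_right (h : s.Joins t u v x y) (e : s.label y = s.label x') :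
    s.Joins t u v x x' := (h.symm.congr_left e).symm

theorem Joins.max_min (h : s.Joins t u v x y) : s.Joins t u v (max x y) (min x y) := by
  obtain hxy | hxy := le_total x y
  · rw [max_eq_right hxy, min_eq_left hxy]; exact h.symm
  · rw [max_eq_left hxy, min_eq_right hxy]; exact h

theorem Joins.inserted (h : s.Joins t u v x y) (e : s.label x = s.label y) :
    s.Inserted t u v :=
  .inr ⟨h.1, by obtain ⟨h, h'⟩ | ⟨h, h'⟩ := h.2 <;> rw [h, h', e]⟩

theorem Inserted.mono (h : s.Inserted t u v) (hs : s'.status t = s.status t)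
    (hl : ∀ x y, s.label x = s.label y → s'.label x = s'.label y) : s'.Inserted t u v := by
  unfold Inserted at *
  rw [hs]
  exact h.imp_right fun h => ⟨h.1, hl _ _ h.2⟩

theorem Inserted.rely (h : s.Inserted t u v) (r : Rely t s s') : s'.Inserted t u v :=
  h.mono r.status fun _ _ => r.conn

theorem Inserted.final (h : s.Inserted t u v) : Prog.Final t .unit s :=
  h.imp_right fun h => ⟨_, h.1, .insertSame _ _ _ h.2⟩

/-- The root `h` is its own label and loses it; whether this is the label of `u` or of `v` decides
between the two forms of insertion. -/
theorem Joins.seqStep {h l : Fin n} (hj : s.Joins t u v h l) (hr : s.mem.parent h = h)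
    (hp : K.Prec s.mem h l) :
    SeqStep s.label (.insert u v) .unit (merge s.label h (s.label l)) := by
  have hne := s.label_ne_of_prec hp
  have hh := s.label_root h hr
  obtain ⟨h₁, h₂⟩ | ⟨h₁, h₂⟩ := hj.2
  · have := SeqStep.insertLeft s.label u v (by rw [h₁, h₂, hh]; exact hne.symm)
    rwa [h₁, h₂, hh] at this
  · have := SeqStep.insertRight s.label u v (by rw [h₁, h₂, hh]; exact hne)
    rwa [h₁, h₂, hh] at this

/-- The outcome of an attempt to link two vertices. -/
def LinkPost (t : θ) (u v a b : Fin n) (ok : Bool) (s : GState K θ) : Prop :=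
  s.Joins t u v a b ∧ ok = false ∨ s.Inserted t u v ∧ ok = true

theorem LinkPost.symm {a b : Fin n} {ok : Bool} (h : LinkPost t u v a b ok s) :
    LinkPost t u v b a ok s :=
  h.imp_left fun h => ⟨h.1.symm, h.2⟩

variable [DecidableEq θ]

theorem spliceGuar (t : θ) : SpliceGuar (K := K) (Guar t) :=
  ⟨Guar.refl t, fun _ _ _ _ _ _ => ⟨fun _ => id, fun t' _ => rely_splice t' ..⟩⟩

theorem rely_addDone (s : GState K θ) {t t' : θ} (ht : t' ≠ t) (r : Ret n) :
    Rely t' s (s.addDone t r) where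
  conn := id
  nonroot := id
  status := by simp [addDone, setStatus, ht]
  owner _ := .rfl
  ownerRoot _ := id
  rank _ := le_rfl
  rankNonroot _ := rfl

theorem queryGuar (t : θ) : QueryGuar (K := K) t (Guar t) :=
  ⟨Guar.refl t, fun s _ _ hs hq => ⟨fun _ hv => hv.addDone hs hq, fun _ ht => s.rely_addDone ht _⟩⟩

theorem guar_link {h l : Fin n} (hj : s.Joins t u v h l) {hr hp hh}
    (ho : ∀ t' ≠ t, s.owner h ≠ some t') :
    Guar t s (s.link h l (Function.update s.status t {.done .unit}) hr hp hh) where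
  valid _ hv := hv.linearize hj.1 (hj.seqStep hr hp)
  rely t' ht := rely_link (by simp [ht]) (ho t' ht)

theorem guar_setOwner {hook : Fin n → Option (Fin n)} {locked : Fin n → Bool}
    {owner : Fin n → Option θ}
    {ho : K.Owned { s.mem with hook := hook, locked := locked } owner}
    (h : ∀ t' ≠ t, ∀ x, owner x = some t' ↔ s.owner x = some t') :
    Guar t s (s.setOwner hook locked owner ho) where
  valid _ := id
  rely t' ht := ⟨id, id, rfl, h t' ht, fun _ => id, fun _ => le_rfl, fun _ => rfl⟩

theorem guar_update_owner {hook : Fin n → Option (Fin n)} {locked : Fin n → Bool} {h : Fin n}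
    {o : Option θ} {ho} (hs : ∀ t' ≠ t, s.owner h ≠ some t' ∧ o ≠ some t') :
    Guar t s (s.setOwner hook locked (Function.update s.owner h o) ho) :=
  guar_setOwner fun t' ht x => by
    by_cases e : x = h
    · subst e; simp [hs t' ht]
    · simp [e]

end GState

open GState

namespace Prog

variable [DecidableEq θ] {t : θ} {s : GState K θ} {α : Type} {Φ : α → GState K θ → Prop}
  {u v h l : Fin n}

/-- Success proves at the instant of the link that `h` is a root. Nothing is needed about `l` except
that it is smaller and in the other tree; it may have been linked meanwhile. -/
theorem wpt_cas_link {f : Bool → Prog n α} (hK : K.Descending) (hc : K.protection = .cas)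
    (hj : s.Joins t u v h l) (hlt : l < h)
    (ht : ∀ s' : GState K θ, s'.Inserted t u v → (f true).wpt t (Guar t) Φ s')
    (hf : (f false).wpt t (Guar t) Φ s) :
    (ConnectIt.cas h h l >>= f).wpt t (Guar t) Φ s := by
  refine fun s' r => ⟨fun e => ?_, fun _ => wpt_stable hf r⟩
  have ho := s'.owned
  simp only [Setting.Owned, hc] at ho
  refine ⟨s'.link h l (Function.update s'.status t {.done .unit}) e (hK.prec_iff.2 hlt)
    (by simp [hc]), rfl, guar_link (hj.rely r) fun _ _ => by simp [ho], ht _ (.inl ?_)⟩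
  simp [link]

/-- Ownership replaces the test: no other thread can have linked `h` since it was seen to be a root.
This write is the linearization point. -/
theorem wpt_write_link {f : Unit → Prog n α} (hK : K.Descending)
    (hj : s.Joins t u v h l) (hlt : l < h) (ho : s.owner h = some t) (hr : s.mem.parent h = h)
    (ht : ∀ s' : GState K θ, s'.Inserted t u v → s'.owner h = some t →
      (f ()).wpt t (Guar t) Φ s') :
    (ConnectIt.write h l >>= f).wpt t (Guar t) Φ s := by
  intro s' r
  have ho' := (r.owner h).2 ho
  refine ⟨s'.link h l (Function.update s'.status t {.done .unit}) (r.ownerRoot ho hr)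
    (hK.prec_iff.2 hlt) (fun hc hn => ?_), rfl, guar_link (hj.rely r) fun t' ht' => ?_,
    ht _ (.inl ?_) ho'⟩
  · have := s'.owned
    simp only [Setting.Owned, hc] at this
    simp [(this h hn).1] at ho'
  · simpa [ho'] using ht'.symm
  · simp [link]

/-- An initial root with a free hook has never been linked. So success makes `t` the owner of a
vertex that is still a root, although its parent is not read again. -/
theorem wpt_casHook {f : Bool → Prog n α} (hc : K.protection = .hook) (hi : K.init h = h)
    (ht : ∀ s' : GState K θ, s'.owner h = some t → s'.mem.parent h = h →
      s'.status t = s.status t → (∀ x y, s.label x = s.label y → s'.label x = s'.label y) →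
      (f true).wpt t (Guar t) Φ s')
    (hf : (f false).wpt t (Guar t) Φ s) :
    (ConnectIt.casHook h l >>= f).wpt t (Guar t) Φ s := by
  refine fun s' r => ⟨fun e => ?_, fun _ => wpt_stable hf r⟩
  have ho := s'.owned
  simp only [Setting.Owned, hc] at ho
  refine ⟨s'.setOwner (Function.update s'.mem.hook h (some l)) s'.mem.locked
    (Function.update s'.owner h (some t)) ?_, rfl, guar_update_owner fun t' ht' => ?_,
    ht _ ?_ ((ho h e).2 hi) r.status fun x y => r.conn⟩
  · simp only [Setting.Owned, hc]
    intro x hx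
    have : x ≠ h := by rintro rfl; simp at hx
    simp only [ne_eq, this, not_false_eq_true, Function.update_of_ne] at hx ⊢
    exact ho x hx
  · simpa [(ho h e).1] using ht'.symm
  · simp [setOwner]

/-- The lock gives ownership but no information about the parent of `h`, which must be read
afterwards. -/
theorem wpt_lock {f : Unit → Prog n α} (hc : K.protection = .lock)
    (ht : ∀ s' : GState K θ, s'.owner h = some t → s'.status t = s.status t →
      (∀ x y, s.label x = s.label y → s'.label x = s'.label y) → (f ()).wpt t (Guar t) Φ s') :
    (ConnectIt.lock h >>= f).wpt t (Guar t) Φ s := by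
  intro s' r e
  have ho := s'.owned
  simp only [Setting.Owned, hc] at ho
  refine ⟨s'.setOwner s'.mem.hook (Function.update s'.mem.locked h true)
    (Function.update s'.owner h (some t)) ?_, rfl, guar_update_owner fun t' ht' => ?_,
    ht _ ?_ r.status fun x y => r.conn⟩
  · simp only [Setting.Owned, hc]
    intro x hx
    have : x ≠ h := by rintro rfl; simp at hx
    simp only [ne_eq, this, not_false_eq_true, Function.update_of_ne] at hx ⊢
    exact ho x hx
  · simpa [ho h e] using ht'.symm
  · simp [setOwner]

theorem wpt_unlock {f : Unit → Prog n α} (hc : K.protection = .lock) (ho : s.owner h = some t)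
    (ht : ∀ s' : GState K θ, s'.status t = s.status t →
      (∀ x y, s.label x = s.label y → s'.label x = s'.label y) → (f ()).wpt t (Guar t) Φ s') :
    (ConnectIt.unlock h >>= f).wpt t (Guar t) Φ s := by
  intro s' r
  have ho' := s'.owned
  simp only [Setting.Owned, hc] at ho'
  refine ⟨s'.setOwner s'.mem.hook (Function.update s'.mem.locked h false)
    (Function.update s'.owner h none) ?_, rfl, guar_update_owner fun t' ht' => ?_,
    ht _ r.status fun x y => r.conn⟩
  · simp only [Setting.Owned, hc]
    intro x hx
    by_cases e : x = h
    · subst e; simp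
    · simp only [ne_eq, e, not_false_eq_true, Function.update_of_ne] at hx ⊢
      exact ho' x hx
  · simpa [(r.owner h).2 ho] using ht'.symm

theorem compressBoth_wpt (hK : K.Descending) (c : FindOption) (hs : s.Inserted t u v) :
    (compressBoth c u v).wpt t (Guar t) (fun _ s => s.Inserted t u v) s := by
  unfold compressBoth
  have hG := spliceGuar (K := K) t
  split_ifs
  · exact wpt_pure fun s' r => hs.rely r
  · exact wpt_bind ((findOption_spec hK hG c).wpt hG.refl fun _ s₁ r₁ _ _ =>
      wpt_bind ((findOption_spec hK hG c).wpt hG.refl fun _ s₂ r₂ _ _ =>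
        wpt_pure fun s₃ r₃ => hs.rely ((r₁.trans r₂).trans r₃)))

/-! ### Unions -/

/-- The specification of `Union`. -/
def UnionSpec (K : Setting n) (t : θ) (union : Fin n → Fin n → Prog n Unit) : Prop :=
  ∀ (u v : Fin n) (s : GState K θ), .pending (.insert u v) ∈ s.status t →
    (union u v).wpt t (Guar t) (fun _ s => s.Inserted t u v) s

theorem unionAsync_spec (hK : K.Descending) (hc : K.protection = .cas) {find}
    (hf : FindSpec (K := K) t (Guar t) find) : UnionSpec K t (unionAsync find) := by
  intro u v s hs
  have hG := spliceGuar (K := K) t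
  refine wpt_loop (fun _ s => s.Joins t u v u v) (Joins.self hs) ?_
  rintro ⟨⟩ s hs
  refine wpt_bind (hf.wpt hG.refl fun a s₁ r₁ ha _ => wpt_bind (hf.wpt hG.refl
    fun b s₂ r₂ hb _ => ?_))
  have h₂ := (((hs.rely r₁).congr_left ha).rely r₂).congr_right hb
  have h₂' := (hs.rely r₁).rely r₂
  split_ifs with hab
  · subst hab
    exact wpt_pure fun s₃ r₃ => (h₂.inserted rfl).rely r₃
  · refine wpt_read hG.refl fun s₃ r₃ => ?_
    split_ifs
    · refine wpt_cas_link hK hc (h₂.max_min.rely r₃) (min_lt_max.2 hab)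
        (fun s₄ h₄ => ?_) ?_
      · exact wpt_pure fun s₅ r₅ => h₄.rely r₅
      · exact wpt_pure fun s₄ r₄ => h₂'.rely (r₃.trans r₄)
    · exact wpt_pure fun s₄ r₄ => h₂'.rely (r₃.trans r₄)

theorem unionHooks_spec (hK : K.Descending) (hc : K.protection = .hook) {find}
    (hf : FindSpec (K := K) t (Guar t) find) : UnionSpec K t (unionHooks find) := by
  intro u v s hs
  have hG := spliceGuar (K := K) t
  refine wpt_loop (fun _ s => s.Joins t u v u v) (Joins.self hs) ?_
  rintro ⟨⟩ s hs
  refine wpt_bind (hf.wpt hG.refl fun a s₁ r₁ ha _ => wpt_bind (hf.wpt hG.refl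
    fun b s₂ r₂ hb _ => ?_))
  have h₂ := (((hs.rely r₁).congr_left ha).rely r₂).congr_right hb
  have h₂' := (hs.rely r₁).rely r₂
  split_ifs with hab
  · subst hab
    exact wpt_pure fun s₃ r₃ => (h₂.inserted rfl).rely r₃
  · refine wpt_read hG.refl fun s₃ r₃ => ?_
    split_ifs with hp
    · refine wpt_casHook hc (s₃.init_root _ hp) (fun s₄ ho hr hst hconn => ?_) ?_
      · have h₃ := h₂.max_min.rely r₃
        exact wpt_write_link hK (h₃.mono hst hconn) (min_lt_max.2 hab) ho hr fun s₅ h₅ _ =>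
          wpt_pure fun s₆ r₆ => h₅.rely r₆
      · exact wpt_pure fun s₄ r₄ => h₂'.rely (r₃.trans r₄)
    · exact wpt_pure fun s₄ r₄ => h₂'.rely (r₃.trans r₄)

theorem unionEarly_spec (hK : K.Descending) (hc : K.protection = .cas) (f : FindOption) :
    UnionSpec K t (unionEarly f) := by
  intro u v s hs
  have hG := spliceGuar (K := K) t
  refine wpt_bind (wpt_loop (fun x s => s.Joins t u v x.1 x.2) (Joins.self hs) ?_)
  rintro ⟨x, y⟩ s hs
  dsimp only at hs ⊢
  split_ifs with hxy
  · subst hxy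
    exact wpt_pure fun s₁ r₁ => compressBoth_wpt hK f ((hs.inserted rfl).rely r₁)
  refine wpt_read hG.refl fun s₁ r₁ => ?_
  have h₁ := hs.max_min.rely r₁
  -- Both ways of not linking, a failed test and a failed `CAS`, continue with the same splice.
  have key : ∀ s₂ : GState K θ, s₂.Joins t u v (max x y) (min x y) →
      (do
        let z ← ConnectIt.read (max x y)
        let w ← ConnectIt.read z
        let _ ← ConnectIt.cas (max x y) z w
        return .inl (w, min x y) : Prog n ((Fin n × Fin n) ⊕ Unit)).wpt t (Guar t)
      (fun r s => match r with
        | .inl i => s.Joins t u v i.1 i.2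
        | .inr _ => (compressBoth f u v).wpt t (Guar t) (fun _ s => s.Inserted t u v) s) s₂ := by
    intro s₂ h₂
    refine wpt_read hG.refl fun s₃ r₃ => wpt_read hG.refl fun s₄ r₄ =>
      wpt_cas hG (s₄.canSplice_parent _) fun _ => wpt_pure fun s₅ r₅ => ?_
    have h₃ := ((h₂.rely r₃).congr_left (s₃.label_parent _).symm).rely r₄
    exact (h₃.congr_left (s₄.label_parent _).symm).rely r₅
  split_ifs
  · refine wpt_cas_link hK hc h₁ (min_lt_max.2 hxy) (fun s₂ h₂ => ?_) ?_
    · exact wpt_pure fun s₃ r₃ => compressBoth_wpt hK f (h₂.rely r₃)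
    · exact key s₁ h₁
  · exact key s₁ h₁

theorem splice_wpt (sp : SpliceOption) {a : Fin n} {Φ : Fin n → GState K θ → Prop}
    (h : ∀ a' s', Rely t s s' → s'.label a = s'.label a' → Φ a' s') :
    (sp.prog a).wpt t (Guar t) Φ s := by
  have hG := spliceGuar (K := K) t
  cases sp
  all_goals
    refine wpt_read hG.refl fun s₁ r₁ => wpt_read hG.refl fun s₂ r₂ => ?_
    have h₁ := r₂.conn (s₁.label_parent a).symm
    have h₂ := h₁.trans (s₂.label_parent _).symm
    split_ifs
    · exact wpt_pure fun s₃ r₃ => h _ _ ((r₁.trans r₂).trans r₃) (r₃.conn (by assumption))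
    · exact wpt_cas hG (s₂.canSplice_parent _) fun _ => wpt_pure fun s₃ r₃ =>
        h _ _ ((r₁.trans r₂).trans r₃) (r₃.conn (by assumption))

theorem unionRemCAS_spec (hK : K.Descending) (hc : K.protection = .cas) (c : FindOption)
    (sp : SpliceOption) : UnionSpec K t (unionRemCAS c sp) := by
  intro u v s hs
  have hG := spliceGuar (K := K) t
  refine wpt_loop (fun x s => s.Joins t u v x.1 x.2) (Joins.self hs) ?_
  rintro ⟨x, y⟩ s hs
  dsimp only at hs ⊢
  refine wpt_read hG.refl fun s₁ r₁ => wpt_read hG.refl fun s₂ r₂ => ?_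
  generalize hp : s₁.mem.parent x = p
  generalize hq : s₂.mem.parent y = q
  have hpx : s₂.label x = s₂.label p := r₂.conn (by rw [← hp, s₁.label_parent])
  have hqy : s₂.label y = s₂.label q := by rw [← hq, s₂.label_parent]
  have hple : p ≤ x := hp ▸ s₁.parent_le hK x
  have hqle : q ≤ y := hq ▸ s₂.parent_le hK y
  have h₂ := (hs.rely r₁).rely r₂
  have h₂' : s₂.Joins t u v (if q < p then x else y) (if q < p then y else x) := by
    split_ifs
    · exact h₂
    · exact h₂.symm
  by_cases hpq : p = q
  · rw [if_pos hpq]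
    exact wpt_pure fun s₃ r₃ => (h₂.inserted (by rw [hpx, hqy, hpq])).rely r₃
  rw [if_neg hpq]
  -- The target is the smaller parent that was read: it lies in the tree of the other vertex `b`,
  -- and it is below the larger parent, hence below `a`.
  have hmin : s₂.label (if q < p then y else x) = s₂.label (min p q) ∧
      min p q < (if q < p then x else y) := by
    split_ifs with hlt
    · rw [min_eq_right hlt.le]; exact ⟨hqy, by omega⟩
    · rw [min_eq_left (not_lt.1 hlt)]; exact ⟨hpx, by omega⟩
  generalize (if q < p then x else y) = a at *
  generalize (if q < p then y else x) = b at *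
  refine wpt_read hG.refl fun s₃ r₃ => ?_
  have h₃ := h₂'.rely r₃
  split_ifs
  · refine wpt_cas_link hK hc ((h₂'.congr_right hmin.1).rely r₃) hmin.2 (fun s₄ h₄ => ?_) ?_
    · rw [if_pos rfl]
      exact wpt_bind (wp_mono (fun _ _ h => wpt_pure fun _ r => h.rely r)
        (compressBoth_wpt hK c h₄))
    · rw [if_neg Bool.false_ne_true]
      exact wpt_bind (splice_wpt sp fun a' s₄ r₄ ha => wpt_pure fun s₅ r₅ =>
        ((h₃.rely r₄).congr_left ha).rely r₅)
  · refine wpt_pure_bind ?_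
    rw [if_neg Bool.false_ne_true]
    exact wpt_bind (splice_wpt sp fun a' s₄ r₄ ha => wpt_pure fun s₅ r₅ =>
      ((h₃.rely r₄).congr_left ha).rely r₅)

theorem unionRemLock_spec (hK : K.Descending) (hc : K.protection = .lock) (c : FindOption)
    (sp : SpliceOption) : UnionSpec K t (unionRemLock c sp) := by
  intro u v s hs
  have hG := spliceGuar (K := K) t
  refine wpt_bind (wpt_loop (fun x s => s.Joins t u v x.1 x.2) (Joins.self hs) ?_)
  rintro ⟨x, y⟩ s hs
  dsimp only at hs ⊢
  have hend : ∀ (b : Bool) (s : GState K θ), s.Inserted t u v →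
      (if b = true then pure () else compressBoth c u v).wpt t (Guar t)
        (fun _ s => s.Inserted t u v) s := by
    intro b s hs
    split_ifs
    · exact wpt_pure fun s' r => hs.rely r
    · exact compressBoth_wpt hK c hs
  refine wpt_read hG.refl fun s₁ r₁ => wpt_read hG.refl fun s₂ r₂ => ?_
  generalize hp : s₁.mem.parent x = p
  generalize hq : s₂.mem.parent y = q
  have hpx : s₂.label x = s₂.label p := r₂.conn (by rw [← hp, s₁.label_parent])
  have hqy : s₂.label y = s₂.label q := by rw [← hq, s₂.label_parent]
  have h₂ := (hs.rely r₁).rely r₂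
  have h₂' : s₂.Joins t u v (if q < p then x else y) (if q < p then y else x) := by
    split_ifs
    · exact h₂
    · exact h₂.symm
  by_cases hpq : p = q
  · rw [if_pos hpq]
    exact wpt_pure fun s₃ r₃ => hend _ _ ((h₂.inserted (by rw [hpx, hqy, hpq])).rely r₃)
  rw [if_neg hpq]
  generalize (if q < p then x else y) = a at *
  generalize (if q < p then y else x) = b at *
  refine wpt_read hG.refl fun s₃ r₃ => ?_
  have h₃ := h₂'.rely r₃
  split_ifs
  · refine wpt_lock hc fun s₄ ho hst hconn => ?_
    have h₄ := h₃.mono hst hconn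
    refine wpt_read hG.refl fun s₅ r₅ => wpt_read hG.refl fun s₆ r₆ => ?_
    have h₅ := h₄.rely r₅
    have ho₆ := ((r₅.trans r₆).owner a).2 ho
    -- The value read from `b` under the lock need not be the earlier parent, so `q < a` comes from
    -- the test and not from the comparison at the head of the loop.
    split_ifs with hcond
    · refine wpt_write_link hK ((h₅.congr_right (s₅.label_parent b).symm).rely r₆) hcond.2 ho₆
        hcond.1 fun s₇ h₇ ho₇ => wpt_unlock hc ho₇ fun s₈ hst₈ hconn₈ => ?_
      exact wpt_pure fun s₉ r₉ => hend _ _ ((h₇.mono hst₈ hconn₈).rely r₉)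
    · refine wpt_unlock hc ho₆ fun s₇ hst₇ hconn₇ => ?_
      exact wpt_pure fun s₈ r₈ => ((h₅.rely r₆).mono hst₇ hconn₇).rely r₈
  · exact wpt_bind (splice_wpt sp fun a' s₅ r₅ ha => wpt_pure fun s₆ r₆ =>
      ((h₃.rely r₅).congr_left ha).rely r₆)

theorem wpt_readWord {x : Fin n} {f : Fin n × ℕ → Prog n α}
    (h : ∀ s', Rely t s s' → (f (s'.mem.parent x, s'.mem.rank x)).wpt t (Guar t) Φ s') :
    (ConnectIt.readWord x >>= f).wpt t (Guar t) Φ s := h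

theorem wpt_coin {f : Bool → Prog n α} (h : ∀ b, (f b).wpt t (Guar t) Φ s) :
    (ConnectIt.coin >>= f).wpt t (Guar t) Φ s :=
  fun _ r b => wpt_stable (h b) r

/-- Success also confirms the rank of `h`, so the order has to be verified only for states in which
this rank is the one that was read. -/
theorem casWord_link_wpt {r : ℕ} (hc : K.protection = .cas) (hj : s.Joins t u v h l)
    (hp : ∀ s', Rely t s s' → s'.mem.rank h = r → K.Prec s'.mem h l) :
    (ConnectIt.casWord h (h, r) (l, r)).wpt t (Guar t) (LinkPost t u v h l) s := by
  refine fun s' hr => ⟨fun e => ?_, fun _ s'' r' => .inl ⟨(hj.rely hr).rely r', rfl⟩⟩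
  obtain ⟨e₁, e₂⟩ := Prod.mk.inj e
  have ho := s'.owned
  simp only [Setting.Owned, hc] at ho
  refine ⟨s'.link h l (Function.update s'.status t {.done .unit}) e₁ (hp s' hr e₂)
    (by simp [hc]), ?_, guar_link (hj.rely hr) fun _ _ => by simp [ho], fun s'' r' => .inr ⟨?_, rfl⟩⟩
  · dsimp only [link]
    rw [← e₂, Function.update_eq_self]
  · exact Inserted.rely (.inl (by simp [link])) r'

theorem casWord_rankUp_wpt {r : ℕ} {Φ : Bool → GState K θ → Prop}
    (h' : ∀ ok s', Rely t s s' → Φ ok s') :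
    (ConnectIt.casWord h (h, r) (h, r + 1)).wpt t (Guar t) Φ s := by
  refine fun s' hr => ⟨fun e => ?_, fun _ s'' r' => h' _ _ (hr.trans r')⟩
  obtain ⟨e₁, e₂⟩ := Prod.mk.inj e
  refine ⟨s'.rankUp h e₁, ?_, ⟨fun _ => id, fun t' _ => rely_rankUp s' e₁ t'⟩, fun s'' r' =>
    h' _ _ ((hr.trans (rely_rankUp s' e₁ t)).trans r')⟩
  dsimp only [rankUp]
  have : Function.update s'.mem.parent h h = s'.mem.parent := by
    conv_rhs => rw [← Function.update_eq_self h s'.mem.parent, e₁]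
  rw [this, e₂]

/-- The word of the linked root is compared as a whole, so its rank is exact. The rank of the other
vertex may be outdated, but it can only have grown, which favors the link. If the ranks were read as
equal, either it has grown since, or `π` breaks the tie. -/
theorem jtbLink_wpt {π : Equiv.Perm (Fin n)} {a b : Fin n} (hc : K.protection = .cas)
    (hmaj : K.major a = K.major b) (hmin : ∀ x, K.minor x = π x) (hab : a ≠ b)
    (hj : s.Joins t u v a b) :
    (jtbLink π a b).wpt t (Guar t) (LinkPost t u v a b) s := by
  refine wpt_readWord fun s₁ r₁ => wpt_readWord fun s₂ r₂ => ?_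
  have hj₂ := (hj.rely r₁).rely r₂
  have ha : s₁.mem.rank a ≤ s₂.mem.rank a := r₂.rank a
  dsimp only
  split_ifs with h₁ h₂ hπ
  · refine casWord_link_wpt hc hj₂ fun s₃ r₃ e => .inr ⟨hmaj, .inl ?_⟩
    have := r₃.rank b
    omega
  · refine wp_mono (fun _ _ => LinkPost.symm) (casWord_link_wpt hc hj₂.symm fun s₃ r₃ e =>
      .inr ⟨hmaj.symm, .inl ?_⟩)
    have := r₃.rank a
    omega
  all_goals
    refine wpt_coin fun c => ?_
    cases c
    · rw [if_neg Bool.false_ne_true]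
      exact wpt_bind (casWord_rankUp_wpt fun ok s₃ r₃ => wpt_pure fun s₄ r₄ =>
        .inl ⟨(hj₂.rely r₃).rely r₄, rfl⟩)
    rw [if_pos rfl]
  · refine casWord_link_wpt hc hj₂ fun s₃ r₃ e => .inr ⟨hmaj, ?_⟩
    have := r₃.rank b
    rw [hmin, hmin]
    have : (π a : ℕ) < π b := hπ
    omega
  · refine wp_mono (fun _ _ => LinkPost.symm) (casWord_link_wpt hc hj₂.symm fun s₃ r₃ e =>
      .inr ⟨hmaj.symm, ?_⟩)
    have := r₃.rank a
    rw [hmin, hmin]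
    have h : (π a : ℕ) ≠ π b := fun e => hab (π.injective (Fin.ext e))
    have : ¬ (π a : ℕ) < π b := hπ
    omega

theorem unionJTB_spec {π : Equiv.Perm (Fin n)} (hc : K.protection = .cas)
    (hmaj : ∀ x y, K.init x = x → K.init y = y → K.major x = K.major y)
    (hmin : ∀ x, K.minor x = π x) {find} (hf : FindSpec (K := K) t (Guar t) find) :
    UnionSpec K t (unionJTB π find) := by
  intro u v s hs
  have hG := spliceGuar (K := K) t
  refine wpt_loop (fun x s => s.Joins t u v x.1 x.2) (Joins.self hs) ?_
  -- `Find` returns vertices that were roots at some time. They were then initial roots, and these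
  -- all lie on one level of `major`.
  rintro ⟨x, y⟩ s hs
  dsimp only at hs ⊢
  refine wpt_bind (hf.wpt hG.refl fun a s₁ r₁ ha hia => wpt_bind (hf.wpt hG.refl
    fun b s₂ r₂ hb hib => ?_))
  have h₂ := (((hs.rely r₁).congr_left ha).rely r₂).congr_right hb
  split_ifs with hab
  · subst hab
    exact wpt_pure fun s₃ r₃ => (h₂.inserted rfl).rely r₃
  · refine wpt_bind (wp_mono ?_ (jtbLink_wpt hc (hmaj a b hia hib) hmin hab h₂))
    rintro ok s₃ (⟨h, rfl⟩ | ⟨h, rfl⟩)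
    · exact wpt_pure fun s₄ r₄ => h.rely r₄
    · exact wpt_pure fun s₄ r₄ => h.rely r₄

end Prog

/-! ### Asynchronous executions -/

/-- The order and the protection of an algorithm. -/
def UFAlg.setting (A : UFAlg n) (P₀ : Fin n → Fin n) : Setting n where
  init := P₀
  major x := match A with
    -- All ranks start at `0` and `π` is arbitrary, so the initial pointers are ordered by a level
    -- of their own.
    | .jtb _ _ => if P₀ x = x then 1 else 0
    | _ => n - x
  minor x := match A with
    | .jtb π _ => π x
    | _ => 0
  protection := match A with
    | .hooks _ => .hook
    | .remLock _ _ => .lock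
    | _ => .cas

/-- The initial state of the proof. -/
def GState.start (K : Setting n) (θ : Type*) (hroot : ∀ v, K.init (K.init v) = K.init v)
    (hprec : ∀ v, K.init v ≠ v → K.Prec (Mem.start K.init) v (K.init v)) : GState K θ where
  mem := .start K.init
  label := K.init
  status _ := {.idle}
  owner _ := none
  label_parent := hroot
  label_root _ h := h
  root_label := hroot
  prec_parent := hprec
  prec_label := hprec
  init_root _ h := h
  owned := by
    unfold Setting.Owned
    cases K.protection <;> simp [Mem.start]

namespace UFAlg

variable [DecidableEq θ] (A : UFAlg n) (P₀ : Fin n → Fin n)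

theorem descending_of_major {K : Setting n} (h : ∀ x, K.major x = n - x) : K.Descending := by
  intro x y hxy
  rw [h, h]
  omega

theorem find_spec (t : θ) : Prog.FindSpec (K := A.setting P₀) t (Guar t) A.find := by
  have hG := spliceGuar (K := A.setting P₀) t
  cases A
  case jtb π f => exact Prog.jtbFindOption_spec hG f
  all_goals exact Prog.findOption_spec (descending_of_major fun _ => rfl) hG _

theorem union_spec (t : θ) : Prog.UnionSpec (A.setting P₀) t A.union := by
  have hf := A.find_spec P₀ t
  cases A
  case async f => exact Prog.unionAsync_spec (descending_of_major fun _ => rfl) rfl hf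
  case hooks f => exact Prog.unionHooks_spec (descending_of_major fun _ => rfl) rfl hf
  case early f => exact Prog.unionEarly_spec (descending_of_major fun _ => rfl) rfl f
  case jtb π f =>
    exact Prog.unionJTB_spec rfl (fun x y hx hy => (if_pos hx).trans (if_pos hy).symm)
      (fun _ => rfl) hf
  case remLock c s => exact Prog.unionRemLock_spec (descending_of_major fun _ => rfl) rfl c s
  case remCAS c s => exact Prog.unionRemCAS_spec (descending_of_major fun _ => rfl) rfl c s

theorem impl_wpt {t : θ} {o : Op n} {s : GState (A.setting P₀) θ} (hs : .pending o ∈ s.status t) :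
    (A.impl o).wpt t (Guar t) (Prog.Final t) s := by
  cases o with
  | insert u v =>
    exact Prog.wpt_bind (Prog.wp_mono (fun _ _ h => Prog.wpt_pure fun _ r => (h.rely r).final)
      (A.union_spec P₀ t u v s hs))
  | find u => exact Prog.find_impl (A.find_spec P₀ t) (queryGuar t) hs
  | isConnected u v => exact Prog.isConnected_impl (A.find_spec P₀ t) (queryGuar t) hs

theorem prec_init (hle : ∀ v, P₀ v ≤ v) (hroot : ∀ v, P₀ (P₀ v) = P₀ v) (v : Fin n)
    (hv : P₀ v ≠ v) : (A.setting P₀).Prec (Mem.start P₀) v (P₀ v) := by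
  cases A
  case jtb π f => exact .inl (by simp [setting, hv, hroot])
  all_goals
    exact (descending_of_major fun _ => rfl).prec_iff.2 (lt_of_le_of_ne (hle v) hv)

end UFAlg

theorem GState.rely_setStatus {t : θ} (s : GState K θ) {S : θ → Set (Status n)}
    (h : S t = s.status t) : Rely t s (s.setStatus S) :=
  ⟨id, id, h, fun _ => .rfl, fun _ => id, fun _ => le_rfl, fun _ => rfl⟩

/-- The state of a thread: idle, or executing the rest of the program of an operation. -/
def ThreadInv (G : θ → GState K θ → GState K θ → Prop) (s : GState K θ) (t : θ) :
    Option (Prog n (Ret n)) → Prop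
  | none => s.status t = {.idle}
  | some p => p.wpt t (G t) (Prog.Final t) s

theorem ThreadInv.rely {G : θ → GState K θ → GState K θ → Prop} {s s' : GState K θ} {t : θ}
    {p : Option (Prog n (Ret n))} (h : ThreadInv G s t p) (r : Rely t s s') :
    ThreadInv G s' t p := by
  cases p with
  | none => exact r.status.trans h
  | some p => exact Prog.wpt_stable h r

/-- A step of `t` is matched by `Prog.wp_step`; the preconditions of the other threads survive
because the guarantee of `t` is what they rely on. -/
theorem UFAlg.run_inv {T : Type*} [DecidableEq T] (A : UFAlg n) {P₀ : Fin n → Fin n}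
    (hle : ∀ v, P₀ v ≤ v) (hroot : ∀ v, P₀ (P₀ v) = P₀ v) {c₀ c : Config T n}
    {H : List (Event T n)} (hc₀ : c₀ = { mem := Mem.start P₀, thr := fun _ => none })
    (h : Run (UFStep A) c₀ H c) :
    ∃ s : GState (A.setting P₀) T, s.mem = c.mem ∧ Valid P₀ H s.label s.status ∧
      ∀ t, ThreadInv Guar s t (c.thr t) := by
  induction h with
  | nil =>
    subst hc₀
    exact ⟨.start _ T hroot (A.prec_init P₀ hle hroot), rfl, .start, fun _ => rfl⟩
  | snoc _ hstep ih =>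
    obtain ⟨s, hm, hv, ht⟩ := ih
    cases hstep with
    | invoke t o hi =>
      have hs : s.status t = {.idle} := (hi ▸ ht t : ThreadInv Guar s t none)
      refine ⟨s.setStatus (Function.update s.status t {.pending o}), hm, hv.invoke (by simp [hs]),
        fun t' => ?_⟩
      by_cases e : t' = t
      · subst e
        simp only [Function.update_self]
        exact A.impl_wpt P₀ (by simp [setStatus])
      · simp only [ne_eq, e, not_false_eq_true, Function.update_of_ne]
        exact (ht t').rely (s.rely_setStatus (by simp [e]))
    | step t p p' m' hp hstep =>
      have hw : ThreadInv Guar s t (some p) := hp ▸ ht t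
      obtain ⟨s', hm', hg, hw'⟩ := Prog.wp_step (Rely.refl t) (fun _ _ _ => Rely.trans)
        (Guar.refl t) hw (hm ▸ hstep)
      refine ⟨s', hm', by rw [List.append_nil]; exact hg.valid _ hv, fun t' => ?_⟩
      by_cases e : t' = t
      · subst e
        simp only [Function.update_self]
        exact hw'
      · simpa [e] using (ht t').rely (hg.rely t' e)
    | respond t r hr =>
      have hw : ThreadInv Guar s t (some (.ret r)) := hr ▸ ht t
      refine ⟨s.setStatus (Function.update s.status t {Status.idle}), hm,
        hv.respond (hw s (.refl t s)), fun t' => ?_⟩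
      by_cases e : t' = t
      · subst e
        simp only [Function.update_self]
        simp [ThreadInv, setStatus]
      · simp only [ne_eq, e, not_false_eq_true, Function.update_of_ne]
        exact (ht t').rely (s.rely_setStatus (by simp [e]))

end ConnectIt

namespace ConnectIt

/-! ### Synchronous batch updates -/

variable {n : ℕ} {T : Type*} {K : Setting n}

/-- The order and the protection in synchronous updates. -/
def syncSetting (P₀ : Fin n → Fin n) : Setting n where
  init := P₀
  major x := n - x
  minor _ := 0
  protection := .cas

/-- The index of the insertion with index `i` in a batch. -/
abbrev edgeOp (T : Type*) (i : ℕ) : T ⊕ ℕ := .inr i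

/-! ### Invocation and return of the edges of a batch. -/

section Batch

variable [DecidableEq T] {P₀ C : Fin n → Fin n} {H : List (Event (T ⊕ ℕ) n)}
  {S : T ⊕ ℕ → Set (Status n)}

/-- The statuses after the invocation of a batch. -/
def batchStatus (S : T ⊕ ℕ → Set (Status n)) (B : List (Fin n × Fin n)) :
    T ⊕ ℕ → Set (Status n)
  | .inl t => S (.inl t)
  | .inr i => match B[i]? with
    | none => {.idle}
    | some e => {.pending (.insert e.1 e.2)}

theorem Valid.batchInv (h : Valid P₀ H C S) (hS : ∀ i, S (edgeOp T i) = {.idle})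
    (B : List (Fin n × Fin n)) : Valid P₀ (H ++ batchInv B) C (batchStatus S B) := by
  induction B using List.reverseRecOn with
  | nil =>
    have : batchStatus S [] = S := by
      funext t
      cases t <;> simp [batchStatus, hS]
    simpa [this, ConnectIt.batchInv] using h
  | append_singleton B e ih =>
    have hi : .idle ∈ batchStatus S B (edgeOp T B.length) := by simp [batchStatus]
    have hs : batchStatus S (B ++ [e]) = Function.update (batchStatus S B) (edgeOp T B.length)
        {.pending (.insert e.1 e.2)} := by
      funext t
      obtain t | i := t
      · simp [batchStatus]
      · by_cases hi : i = B.length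
        · subst hi; simp [batchStatus]
        · obtain hlt | hlt := Nat.lt_or_gt_of_ne hi
          · simp [batchStatus, hi, List.getElem?_append_left hlt]
          · simp [batchStatus, hi, List.getElem?_eq_none (l := B) hlt.le,
              List.getElem?_eq_none (l := B ++ [e]) (i := i) (by simpa using hlt)]
    have := ih.invoke (o := .insert e.1 e.2) hi
    rw [hs]
    simpa [ConnectIt.batchInv, List.zipIdx_append, List.append_assoc] using this

/-- Induction on the number of edges that have returned. An edge that made no link gets its
linearization point here, which leaves the labeling unchanged for the next ones. -/
theorem Valid.batchRes (h : Valid P₀ H C S) (B : List (Fin n × Fin n))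
    (hS : ∀ i, B[i]? = none → S (edgeOp T i) = {.idle})
    (hr : ∀ i e, B[i]? = some e → Valid.Returns C (S (edgeOp T i)) .unit) :
    Valid P₀ (H ++ batchRes B) C (batchStatus S []) := by
  have key : ∀ k ≤ B.length, Valid P₀ (H ++ (List.range k).map fun i => .res (.inr i) .unit) C
      fun t => match t with
        | .inl t => S (.inl t)
        | .inr i => if i < k then {.idle} else S (.inr i) := by
    intro k
    induction k with
    | zero =>
      intro _
      convert h using 1
      · simp
      · funext t
        cases t <;> simp
    | succ k ih =>
      intro hk
      have := (ih (by omega)).respond (t := .inr k) (r := .unit) (by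
        simpa using hr k B[k] (List.getElem?_eq_getElem (by omega)))
      convert this using 1
      · simp [List.range_succ]
      · funext t
        obtain t | i := t
        · simp
        · by_cases e : i = k
          · subst e; simp
          · have : i < k + 1 ↔ i < k := by omega
            simp [e, this]
  convert key B.length le_rfl using 1
  · rfl
  funext t
  obtain t | i := t
  · simp [batchStatus]
  · by_cases e : i < B.length
    · simp [batchStatus, e]
    · simpa [batchStatus, e] using (hS i (List.getElem?_eq_none (not_lt.1 e))).symm

end Batch

/-! ### States during the update of a batch. -/

namespace GState

/-- What the update of a batch may rely on when queries take steps. -/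
structure RelyUpd (s s' : GState K (T ⊕ ℕ)) : Prop where
  mem : s'.mem = s.mem
  label : s'.label = s.label
  status : ∀ i, s'.status (edgeOp T i) = s.status (edgeOp T i)

theorem RelyUpd.refl (s : GState K (T ⊕ ℕ)) : RelyUpd s s := ⟨rfl, rfl, fun _ => rfl⟩

theorem RelyUpd.trans {s s' s'' : GState K (T ⊕ ℕ)} (h : RelyUpd s s') (h' : RelyUpd s' s'') :
    RelyUpd s s'' :=
  ⟨h'.mem.trans h.mem, h'.label.trans h.label, fun i => (h'.status i).trans (h.status i)⟩

/-- The update of a batch only shortens paths. -/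
structure Shortens (s s' : GState K (T ⊕ ℕ)) : Prop where
  parent_le : ∀ x, s'.mem.parent x ≤ s.mem.parent x
  label : s'.label = s.label
  status : ∀ i, s'.status (edgeOp T i) = s.status (edgeOp T i)

theorem RelyUpd.shortens {s s' : GState K (T ⊕ ℕ)} (h : RelyUpd s s') : Shortens s s' :=
  ⟨fun x => by rw [h.mem], h.label, h.status⟩

theorem Shortens.trans {s s' s'' : GState K (T ⊕ ℕ)} (h : Shortens s s') (h' : Shortens s' s'') :
    Shortens s s'' :=
  ⟨fun x => (h'.parent_le x).trans (h.parent_le x), h'.label.trans h.label,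
    fun i => (h'.status i).trans (h.status i)⟩

/-- All trees have depth at most one. -/
def Flat (s : GState K (T ⊕ ℕ)) : Prop :=
  ∀ x, s.mem.parent (s.mem.parent x) = s.mem.parent x

/-- Every insertion of the batch `B` is pending, or done and its endpoints are connected. -/
structure BatchInv (B : List (Fin n × Fin n)) (s : GState K (T ⊕ ℕ)) : Prop where
  idle : ∀ i, B[i]? = none → s.status (edgeOp T i) = {.idle}
  edge : ∀ i e, B[i]? = some e → .pending (.insert e.1 e.2) ∈ s.status (edgeOp T i) ∨
    .done .unit ∈ s.status (edgeOp T i) ∧ s.label e.1 = s.label e.2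

/-- All insertions of the batch `B` may return. -/
structure BatchFinal (B : List (Fin n × Fin n)) (s : GState K (T ⊕ ℕ)) : Prop where
  flat : s.Flat
  idle : ∀ i, B[i]? = none → s.status (edgeOp T i) = {.idle}
  edge : ∀ i e, B[i]? = some e → s.Inserted (edgeOp T i) e.1 e.2

variable {s s' : GState K (T ⊕ ℕ)} {B D : List (Fin n × Fin n)}

theorem BatchInv.congr (h : BatchInv B s) (hl : s'.label = s.label)
    (hs : ∀ i, s'.status (edgeOp T i) = s.status (edgeOp T i)) : BatchInv B s' :=
  ⟨fun i hi => (hs i).trans (h.idle i hi), fun i e he => by rw [hs, hl]; exact h.edge i e he⟩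

theorem BatchInv.final (h : BatchInv B s) (hf : s.Flat)
    (he : ∀ e ∈ B, s.label e.1 = s.label e.2) : BatchFinal B s :=
  ⟨hf, h.idle, fun i e hi => (h.edge i e hi).elim
    (fun h => .inr ⟨h, he e (List.mem_of_getElem? hi)⟩) fun h => .inl h.1⟩

/-- Some edge of `B` joins the trees of `x` and `y`. -/
def EdgeBetween (B : List (Fin n × Fin n)) (s : GState K (T ⊕ ℕ)) (x y : Fin n) : Prop :=
  ∃ e ∈ B, s.label e.1 = s.label x ∧ s.label e.2 = s.label y ∨
    s.label e.1 = s.label y ∧ s.label e.2 = s.label x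

/-- The edges `D` connect the same trees as the edges `B`. -/
structure SameEdges (B D : List (Fin n × Fin n)) (s : GState K (T ⊕ ℕ)) : Prop where
  of_mem : ∀ d ∈ D, ∃ e ∈ B, s.label e.1 = s.label d.1 ∧ s.label e.2 = s.label d.2
  mem_of : ∀ e ∈ B, ∃ d ∈ D, s.label e.1 = s.label d.1 ∧ s.label e.2 = s.label d.2

theorem SameEdges.refl : SameEdges B B s :=
  ⟨fun d hd => ⟨d, hd, rfl, rfl⟩, fun d hd => ⟨d, hd, rfl, rfl⟩⟩

theorem SameEdges.mono (h : SameEdges B D s)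
    (hl : ∀ x y, s.label x = s.label y → s'.label x = s'.label y) : SameEdges B D s' :=
  ⟨fun d hd => (h.of_mem d hd).imp fun _ h => ⟨h.1, hl _ _ h.2.1, hl _ _ h.2.2⟩,
    fun e he => (h.mem_of e he).imp fun _ h => ⟨h.1, hl _ _ h.2.1, hl _ _ h.2.2⟩⟩

/-- A vertex and its parent have the same label, so altered edges join the same trees. -/
theorem SameEdges.relabel (h : SameEdges B D s) :
    SameEdges B (relabel s.mem.parent D) s := by
  refine ⟨fun d hd => ?_, fun e he => ?_⟩
  · obtain ⟨d', hd', rfl⟩ := List.mem_map.1 hd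
    simpa [s.label_parent] using h.of_mem d' hd'
  · obtain ⟨d, hd, h₁, h₂⟩ := h.mem_of e he
    exact ⟨_, List.mem_map_of_mem hd, by simpa [s.label_parent] using ⟨h₁, h₂⟩⟩

theorem EdgeBetween.of_isCandidate (h : SameEdges B D s) {P : Fin n → Fin n} {x y : Fin n}
    (hc : IsCandidate P D x y) : EdgeBetween B s x y := by
  obtain hd | hd := hc.1
  · obtain ⟨e, he, h⟩ := h.of_mem _ hd
    exact ⟨e, he, .inl h⟩
  · obtain ⟨e, he, h⟩ := h.of_mem _ hd
    exact ⟨e, he, .inr h⟩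

variable [DecidableEq T]

/-- What the update of a batch guarantees to the queries. -/
structure GuarUpd (s s' : GState K (T ⊕ ℕ)) : Prop where
  valid : ∀ H, Valid K.init H s.label s.status → Valid K.init H s'.label s'.status
  rely : ∀ t, Rely (.inl t) s s'

theorem GuarUpd.refl (s : GState K (T ⊕ ℕ)) : GuarUpd s s := ⟨fun _ => id, fun _ => .refl _ s⟩

/-- What a query guarantees to the other queries and to the update of a batch. -/
structure GuarQuery (t : T ⊕ ℕ) (s s' : GState K (T ⊕ ℕ)) : Prop where
  guar : Guar t s s'
  relyUpd : RelyUpd s s'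

theorem GuarQuery.refl (t : T ⊕ ℕ) (s : GState K (T ⊕ ℕ)) : GuarQuery t s s :=
  ⟨.refl t s, .refl s⟩

theorem queryGuar_guarQuery (t : T) : QueryGuar (K := K) (.inl t) (GuarQuery (.inl t)) :=
  ⟨GuarQuery.refl _, fun s o r hs hq => ⟨(queryGuar _).addDone s o r hs hq, rfl, rfl, fun i => by
    simp [addDone, setStatus, edgeOp]⟩⟩

/-- An edge of the batch that joins the trees of `h` and `l` must still be pending: were it done,
its endpoints would have one label, but the root `h` is not the label of `l`. So the link can be
charged to this edge. -/
theorem exists_link (hK : K.Descending) (hc : K.protection = .cas) (hB : BatchInv B s)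
    {h l : Fin n} (he : EdgeBetween B s h l) (hr : s.mem.parent h = h) (hlt : l < h) :
    ∃ s' : GState K (T ⊕ ℕ),
      s'.mem = { s.mem with parent := Function.update s.mem.parent h l } ∧ GuarUpd s s' ∧
      BatchInv B s' ∧ ∀ x y, s.label x = s.label y → s'.label x = s'.label y := by
  obtain ⟨e, heB, he⟩ := he
  obtain ⟨i, hi⟩ := List.mem_iff_getElem?.1 heB
  have hp : K.Prec s.mem h l := hK.prec_iff.2 hlt
  have ho := s.owned
  simp only [Setting.Owned, hc] at ho
  have hne := s.label_ne_of_prec hp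
  have hj : s.Joins (edgeOp T i) e.1 e.2 h l := by
    refine ⟨(hB.edge i e hi).resolve_right fun hd => hne ?_, he⟩
    have hh := s.label_root h hr
    obtain ⟨h₁, h₂⟩ | ⟨h₁, h₂⟩ := he
    · rw [← h₂, ← hd.2, h₁, hh]
    · rw [← h₁, hd.2, h₂, hh]
  have hg := guar_link (hr := hr) (hp := hp) (hh := fun h => by simp [hc] at h) hj fun _ _ => by simp [ho]
  have hconn : ∀ x y, s.label x = s.label y →
      merge s.label h (s.label l) x = merge s.label h (s.label l) y := fun x y e => by
    simp [merge, e]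
  refine ⟨_, rfl, ⟨hg.valid, fun t => hg.rely (.inl t) (by simp [edgeOp])⟩, ⟨fun j hj => ?_,
    fun j e' he' => ?_⟩, hconn⟩
  · have : j ≠ i := fun e' => by rw [e', hi] at hj; cases hj
    simpa [link, this, edgeOp] using hB.idle j hj
  · by_cases e : j = i
    · subst e
      obtain rfl := Option.some.inj (hi.symm.trans he')
      refine .inr ⟨by simp [link], ?_⟩
      have hh := s.label_root h hr
      obtain ⟨h₁, h₂⟩ | ⟨h₁, h₂⟩ := he <;> simp [link, merge, h₁, h₂, hh]
    · have := (hB.edge j e' he').imp_right fun h => And.imp_right (hconn _ _) h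
      simpa [link, e, edgeOp] using this

end GState

open GState

/-! ### Parallel writes, and the specifications of the batch algorithms. -/

theorem hookTargets_some {P : Fin n → Fin n} {D : List (Fin n × Fin n)} {h c : Fin n}
    (hc : hookTargets P D h = some c) : IsCandidate P D h c := by
  unfold hookTargets at hc
  split_ifs at hc with hne
  have := Finset.min'_mem _ hne
  rw [Option.some.inj hc] at this
  exact (Finset.mem_filter.1 this).2

theorem hookTargets_none {P : Fin n → Fin n} {D : List (Fin n × Fin n)} {h : Fin n}
    (hn : hookTargets P D h = none) (c : Fin n) : ¬IsCandidate P D h c := by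
  unfold hookTargets at hn
  split_ifs at hn with hne
  exact fun hc => hne ⟨c, Finset.mem_filter.2 ⟨Finset.mem_univ _, hc⟩⟩

/-- Without candidates, edges between roots are loops. -/
theorem eq_of_hookTargets_none {P : Fin n → Fin n} {D : List (Fin n × Fin n)}
    (hn : ∀ h, hookTargets P D h = none) {d : Fin n × Fin n} (hd : d ∈ D) (h₁ : P d.1 = d.1)
    (h₂ : P d.2 = d.2) : d.1 = d.2 := by
  by_contra hne
  obtain hlt | hlt := lt_or_gt_of_ne hne
  · exact hookTargets_none (hn d.2) d.1 ⟨.inr hd, h₂, hlt⟩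
  · exact hookTargets_none (hn d.1) d.2 ⟨.inl hd, h₁, hlt⟩

namespace Prog

variable [DecidableEq T] {α β : Type} {Φ : α → GState K (T ⊕ ℕ) → Prop}
  {s : GState K (T ⊕ ℕ)} {B : List (Fin n × Fin n)}

/-- The weakest precondition for the update of a batch. -/
abbrev wpu (p : Prog n α) (Φ : α → GState K (T ⊕ ℕ) → Prop) (s : GState K (T ⊕ ℕ)) : Prop :=
  p.wp RelyUpd GuarUpd Φ s

theorem wpu_stable {p : Prog n α} {s' : GState K (T ⊕ ℕ)} (h : p.wpu Φ s) (hr : RelyUpd s s') :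
    p.wpu Φ s' :=
  wp_stable (R := RelyUpd) (fun _ _ _ => RelyUpd.trans) h hr

theorem wpu_pure {a : α} (h : ∀ s', RelyUpd s s' → Φ a s') : (pure a : Prog n α).wpu Φ s := h

theorem wpu_bind {p : Prog n β} {f : β → Prog n α} (h : p.wpu (fun b s => (f b).wpu Φ s) s) :
    (p >>= f).wpu Φ s :=
  wp_bind RelyUpd.refl h

theorem wpu_snapshot {f : (Fin n → Fin n) → Prog n α}
    (h : ∀ s', RelyUpd s s' → (f s'.mem.parent).wpu Φ s') :
    (ConnectIt.snapshot >>= f).wpu Φ s := h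

theorem wpu_loop {σ : Type} {i : σ} {body : σ → Prog n (σ ⊕ α)}
    (I : σ → GState K (T ⊕ ℕ) → Prop) (hi : I i s) (hb : ∀ i s, I i s → (body i).wpu
      (fun r s => match r with | .inl i => I i s | .inr b => Φ b s) s) :
    (ConnectIt.loop i body).wpu Φ s := by
  refine fun s' hr => ⟨fun i s => ∃ s₀, I i s₀ ∧ RelyUpd s₀ s, ⟨_, hi, hr⟩, ?_⟩
  rintro i s ⟨s₀, hI, hr⟩
  refine wp_mono ?_ (wpu_stable (wp_closure (R := RelyUpd) (fun _ _ _ => RelyUpd.trans) (hb i s₀ hI)) hr)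
  rintro (i' | b) s' h'
  · exact ⟨_, h' _ (.refl s'), .refl s'⟩
  · exact h'

/-- The rule for parallel writes, with an invariant `J` besides the fact that every location has
its old or its new value. -/
theorem wpu_bulk {W : Fin n → Option (Fin n)} {Φ : Unit → GState K (T ⊕ ℕ) → Prop}
    (J : GState K (T ⊕ ℕ) → Prop) (hJ : J s) (hst : ∀ s s', J s → RelyUpd s s' → J s')
    (hw : ∀ s', J s' → ∀ x y, W x = some y → s'.mem.parent x = s.mem.parent x →
      ∃ s'' : GState K (T ⊕ ℕ),
        s''.mem = { s'.mem with parent := Function.update s'.mem.parent x y } ∧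
          GuarUpd s' s'' ∧ J s'')
    (hk : ∀ s', J s' → (∀ x, s'.mem.parent x = (W x).getD (s.mem.parent x)) → Φ () s') :
    (ConnectIt.bulk W).wpu Φ s := by
  intro s₁ r₁
  refine ⟨fun W' s' => J s' ∧ ∀ x, W' x = W x ∧ s'.mem.parent x = s.mem.parent x ∨
    W' x = none ∧ s'.mem.parent x = (W x).getD (s.mem.parent x),
    ⟨hst _ _ hJ r₁, fun x => .inl ⟨rfl, by rw [r₁.mem]⟩⟩, ?_⟩
  rintro W' s₂ ⟨h₂, hW⟩ s₃ r₃
  have h₃ := hst _ _ h₂ r₃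
  rw [← r₃.mem] at hW
  refine ⟨fun x y hx => ?_, fun hn s₄ r₄ => hk s₄ (hst _ _ h₃ r₄) fun x => ?_⟩
  · obtain ⟨e₁, e₂⟩ := (hW x).resolve_right (by simp [hx])
    obtain ⟨s₄, hm, hg, h₄⟩ := hw s₃ h₃ x y (e₁ ▸ hx) e₂
    refine ⟨s₄, hm, hg, h₄, fun x' => ?_⟩
    by_cases e : x' = x
    · subst e
      exact .inr ⟨by simp, by simp [hm, ← e₁, hx]⟩
    · simpa [hm, e] using hW x'
  · rw [r₄.mem]
    obtain ⟨e₁, e₂⟩ | ⟨-, e₂⟩ := hW x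
    · rw [e₂, ← e₁, hn]; rfl
    · exact e₂

/-- Targets are computed from a snapshot, but each write remains a valid link when it becomes
visible: labels have only been merged since, so the edge still joins the two trees, and a root keeps
its self-parent until its own single write. Descending indices exclude cycles in any order of the
writes. -/
theorem hook_wpu {Φ : Unit → GState K (T ⊕ ℕ) → Prop} (hK : K.Descending)
    (hc : K.protection = .cas) (hB : BatchInv B s)
    {D : List (Fin n × Fin n)} (hD : SameEdges B D s)
    (hk : ∀ s', BatchInv B s' → (∀ x y, s.label x = s.label y → s'.label x = s'.label y) →
      (∀ x, s'.mem.parent x = (hookTargets s.mem.parent D x).getD (s.mem.parent x)) → Φ () s') :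
    (ConnectIt.bulk (hookTargets s.mem.parent D)).wpu Φ s := by
  refine wpu_bulk (fun s' => BatchInv B s' ∧
    ∀ x y, s.label x = s.label y → s'.label x = s'.label y) ⟨hB, fun _ _ => id⟩ ?_ ?_
    fun s' h => hk s' h.1 h.2
  · exact fun s₁ s₂ h r => ⟨h.1.congr r.label r.status, r.label ▸ h.2⟩
  · intro s₁ h₁ x y hx hp
    have hx := hookTargets_some hx
    obtain ⟨s₂, hm, hg, hB₂, hl⟩ := exists_link hK hc h₁.1 (.of_isCandidate (hD.mono h₁.2) hx)
      (hp.trans hx.2.1) hx.2.2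
    exact ⟨s₂, hm, hg, hB₂, fun x y e => hl _ _ (h₁.2 _ _ e)⟩

/-- The grandparent in the snapshot has the same label and comes later in the order. Labels and
ranks do not change during the step, so each write is a splice, irrespective of the others. -/
theorem shortcutTargets_wpu {Φ : Unit → GState K (T ⊕ ℕ) → Prop}
    (hk : ∀ s', s'.label = s.label → (∀ i, s'.status (edgeOp T i) = s.status (edgeOp T i)) →
      (∀ x, s'.mem.parent x = s.mem.parent (s.mem.parent x)) → Φ () s') :
    (ConnectIt.bulk (shortcutTargets s.mem.parent)).wpu Φ s := by
  refine wpu_bulk (fun s' => s'.label = s.label ∧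
    (∀ i, s'.status (edgeOp T i) = s.status (edgeOp T i)) ∧ s'.mem.rank = s.mem.rank)
    ⟨rfl, fun _ => rfl, rfl⟩ ?_ ?_ ?_
  · exact fun s₁ s₂ h r => ⟨r.label.trans h.1, fun i => (r.status i).trans (h.2.1 i),
      by rw [r.mem]; exact h.2.2⟩
  · rintro s₁ ⟨hl, hs, hrk⟩ x y hx hp
    unfold shortcutTargets at hx
    split_ifs at hx with hne
    obtain rfl := Option.some.inj hx
    have hx : s.mem.parent x ≠ x := fun e => hne (by rw [e, e])
    have hprec : K.Prec s₁.mem x (s.mem.parent (s.mem.parent x)) :=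
      ((s.prec_parent x hx).trans (s.prec_parent _ hne)).congr (congrFun hrk _)
        (congrFun hrk _).ge
    exact ⟨s₁.splice x _ (hp ▸ hx) (by rw [hl, s.label_parent, s.label_parent]) hprec, rfl,
      ⟨fun _ => id, fun t => rely_splice _ ..⟩, hl, hs, hrk⟩
  · rintro s₁ ⟨hl, hs, -⟩ hp
    refine hk s₁ hl hs fun x => ?_
    rw [hp, shortcutTargets]
    split_ifs with e
    · exact e.symm
    · rfl

/-- If the step changes no parent, then `P ∘ P = P`; this is how a single shortcut reveals flat
trees. -/
theorem shortcut_wpu {Φ : Unit → GState K (T ⊕ ℕ) → Prop} (hK : K.Descending)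
    (hk : ∀ s', Shortens s s' → (s'.mem.parent = s.mem.parent → s'.Flat) → Φ () s') :
    (ConnectIt.shortcut : Prog n Unit).wpu Φ s := by
  refine wpu_snapshot fun s₁ r₁ => shortcutTargets_wpu fun s₂ hl hs hp => hk s₂
    (r₁.shortens.trans ⟨fun x => hp x ▸ s₁.parent_le hK _, hl, hs⟩) fun e x => ?_
  rw [e, ← r₁.mem, ← hp, e, r₁.mem]

theorem fullShortcut_wpu {Φ : Unit → GState K (T ⊕ ℕ) → Prop} (hK : K.Descending)
    (hk : ∀ s', Shortens s s' → s'.Flat → Φ () s') :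
    (ConnectIt.fullShortcut : Prog n Unit).wpu Φ s := by
  refine wpu_loop (fun _ s₁ => Shortens s s₁) (RelyUpd.refl s).shortens ?_
  rintro ⟨⟩ s₁ h₁
  refine wpu_snapshot fun s₂ r₂ => ?_
  have h₂ := h₁.trans r₂.shortens
  split_ifs with hf
  · exact wpu_pure fun s₃ r₃ => hk s₃ (h₂.trans r₃.shortens) (by
      unfold Flat; rw [r₃.mem]; exact hf)
  · exact wpu_bind (shortcutTargets_wpu fun s₃ hl hs hp => wpu_pure fun s₄ r₄ =>
      (h₂.trans ⟨fun x => hp x ▸ s₂.parent_le hK _, hl, hs⟩).trans r₄.shortens)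

/-- Flat trees at the start of a round make the parents of all endpoints roots. If no root has a
candidate, then the two parents of every edge coincide. -/
theorem svUpdate_wpu (hK : K.Descending) (hc : K.protection = .cas) (hB : BatchInv B s)
    (hf : s.Flat) : (svUpdate B).wpu (fun _ s => BatchFinal B s) s := by
  refine wpu_loop (fun _ s => BatchInv B s ∧ s.Flat) ⟨hB, hf⟩ ?_
  rintro ⟨⟩ s ⟨hB, hf⟩
  refine wpu_snapshot fun s₁ r₁ => ?_
  have hB₁ := hB.congr r₁.label r₁.status
  have hf₁ : s₁.Flat := by unfold Flat; rw [r₁.mem]; exact hf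
  refine wpu_bind (hook_wpu hK hc hB₁ SameEdges.refl.relabel fun s₂ hB₂ hl₂ _ =>
    wpu_bind (fullShortcut_wpu hK fun s₃ h₃ hf₃ => ?_))
  have hB₃ := hB₂.congr h₃.label h₃.status
  split_ifs with hW
  · refine wpu_pure fun s₄ r₄ => BatchInv.final (hB₃.congr r₄.label r₄.status)
      (by unfold Flat; rw [r₄.mem]; exact hf₃) fun e he => ?_
    rw [r₄.label, h₃.label]
    refine hl₂ _ _ ?_
    have : s₁.mem.parent e.1 = s₁.mem.parent e.2 := eq_of_hookTargets_none hW (List.mem_map_of_mem he) (hf₁ _) (hf₁ _)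
    rw [← s₁.label_parent, this, s₁.label_parent]
  · exact wpu_pure fun s₄ r₄ => ⟨hB₃.congr r₄.label r₄.status,
      by unfold Flat; rw [r₄.mem]; exact hf₃⟩

/-- A hook strictly lowers a parent and shortcuts never raise it, so a round that changes nothing
has no candidates. Its shortcut phase then shows that the trees are flat, and edges between roots
without candidates are loops. -/
theorem ltUpdate_wpu (hK : K.Descending) (hc : K.protection = .cas) (a : LTVariant)
    (hB : BatchInv B s) : (ltUpdate a B).wpu (fun _ s => BatchFinal B s) s := by
  refine wpu_loop (fun E s => BatchInv B s ∧ SameEdges B E s) ⟨hB, .refl⟩ ?_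
  rintro E s ⟨hB, hE⟩
  refine wpu_snapshot fun s₁ r₁ => ?_
  have hB₁ := hB.congr r₁.label r₁.status
  have hE₁ : SameEdges B E s₁ := hE.mono fun x y e => by rwa [r₁.label]
  generalize hD : (if a.parentConnect = true then relabel s₁.mem.parent E else E) = D
  have hD₁ : SameEdges B D s₁ := by
    rw [← hD]
    split_ifs
    · exact hE₁.relabel
    · exact hE₁
  refine wpu_bind (hook_wpu hK hc hB₁ hD₁ fun s₂ hB₂ hl₂ hp₂ => ?_)
  dsimp only
  by_cases hfs : a.fullShortcut = true
  on_goal 1 => rw [if_pos hfs]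
  on_goal 2 => rw [if_neg hfs]
  all_goals
    -- One argument serves both kinds of shortcut: after the full one flatness is unconditional,
    -- after the single one it holds if no parent changed.
    first
    | refine wpu_bind (fullShortcut_wpu hK fun s₃ h₃ hf => ?_)
      have hf₃ : s₃.mem.parent = s₂.mem.parent → s₃.Flat := fun _ => hf
    | refine wpu_bind (shortcut_wpu hK fun s₃ h₃ hf₃ => ?_)
    refine wpu_snapshot fun s₄ r₄ => ?_
    have h₄ := h₃.trans r₄.shortens
    have hB₄ := hB₂.congr h₄.label h₄.status
    have hl₄ : ∀ x y, s₁.label x = s₁.label y → s₄.label x = s₄.label y := h₄.label ▸ hl₂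
    by_cases hend : s₄.mem.parent = s₁.mem.parent ∧
        (if a.alter = true then relabel s₄.mem.parent E else E) = E
    · rw [if_pos hend]
      obtain ⟨hQ, hE'⟩ := hend
      have hn : ∀ x, hookTargets s₁.mem.parent D x = none := fun x => by
        by_contra hne
        obtain ⟨c, hx⟩ := Option.ne_none_iff_exists'.1 hne
        have hle := h₄.parent_le x
        have hcand := hookTargets_some hx
        rw [hQ, hp₂, hx, hcand.2.1] at hle
        exact absurd hcand.2.2 (not_lt.2 hle)
      have hP₂ : s₂.mem.parent = s₁.mem.parent := funext fun x => by rw [hp₂, hn]; rfl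
      have hf₁ : ∀ x, s₁.mem.parent (s₁.mem.parent x) = s₁.mem.parent x := by
        have := hf₃ (by rw [hP₂, ← hQ, r₄.mem])
        unfold Flat at this
        rwa [← r₄.mem, hQ] at this
      -- With `ParentConnect` the compared vertices are parents in flat trees. With `Connect` the
      -- variant also alters, and an edge that its labels do not change has roots as endpoints.
      have hroots : ∀ d ∈ D, s₁.mem.parent d.1 = d.1 ∧ s₁.mem.parent d.2 = d.2 := by
        intro d hd
        rw [← hD] at hd
        split_ifs at hd with hpc
        · obtain ⟨d, -, rfl⟩ := List.mem_map.1 hd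
          exact ⟨hf₁ _, hf₁ _⟩
        · have ha : a.alter = true := by cases a <;> simp_all [LTVariant.alter, LTVariant.parentConnect]
          rw [if_pos ha, hQ, relabel] at hE'
          have hfix := List.map_inj_left.1 (hE'.trans (List.map_id E).symm) d hd
          exact ⟨congrArg Prod.fst hfix, congrArg Prod.snd hfix⟩
      refine wpu_pure fun s₅ r₅ => BatchInv.final (hB₄.congr r₅.label r₅.status) ?_ fun e he => ?_
      · unfold Flat
        rw [r₅.mem, hQ]
        exact hf₁
      · obtain ⟨d, hd, h₁, h₂⟩ := hD₁.mem_of e he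
        rw [r₅.label]
        refine hl₄ _ _ ?_
        rw [h₁, h₂, eq_of_hookTargets_none hn hd (hroots d hd).1 (hroots d hd).2]
    · rw [if_neg hend]
      have hE₄ := hE₁.mono hl₄
      refine wpu_pure fun s₅ r₅ => ⟨hB₄.congr r₅.label r₅.status, ?_⟩
      refine SameEdges.mono (s := s₄) ?_ fun x y e => by rwa [r₅.label]
      split_ifs
      · exact hE₄.relabel
      · exact hE₄

theorem update_wpu (hK : K.Descending) (hc : K.protection = .cas) (A : SyncAlg)
    (hB : BatchInv B s) (hf : s.Flat) : (A.update B).wpu (fun _ s => BatchFinal B s) s := by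
  cases A with
  | shiloachVishkin => exact svUpdate_wpu hK hc hB hf
  | liuTarjan a => exact ltUpdate_wpu hK hc a hB

theorem query_wpt {t : T} {q : Query n} {s : GState K (T ⊕ ℕ)}
    (hs : .pending q.toOp ∈ s.status (.inl t)) :
    q.impl.wpt (.inl t) (GuarQuery (.inl t)) (Final (.inl t)) s := by
  have hf := findNaive_spec (t := (.inl t : T ⊕ ℕ)) (K := K) (GuarQuery.refl (.inl t))
  cases q with
  | find u => exact find_impl hf (queryGuar_guarQuery t) hs
  | isConnected u v => exact isConnected_impl hf (queryGuar_guarQuery t) hs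

end Prog

/-! ### Executions with batches and concurrent queries. -/

/-- The state of the current batch: none, or executing the rest of the program of its update. -/
def UpdateInv [DecidableEq T] (s : GState K (T ⊕ ℕ)) :
    Option (List (Fin n × Fin n) × Prog n Unit) → Prop
  | none => s.Flat ∧ ∀ i, s.status (edgeOp T i) = {.idle}
  | some (B, p) => p.wpu (fun _ s => BatchFinal B s) s

theorem UpdateInv.relyUpd [DecidableEq T] {s s' : GState K (T ⊕ ℕ)}
    {u : Option (List (Fin n × Fin n) × Prog n Unit)} (h : UpdateInv s u) (r : RelyUpd s s') :
    UpdateInv s' u := by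
  cases u with
  | none => exact ⟨by unfold Flat; rw [r.mem]; exact h.1, fun i => (r.status i).trans (h.2 i)⟩
  | some p => exact Prog.wpu_stable h r

/-- Between batches the trees are flat, which Shiloach–Vishkin needs at the start of the next one.
Queries satisfy `RelyUpd`, so they preserve the precondition of the running update, and its steps
preserve theirs by `GuarUpd`. -/
theorem SyncAlg.run_inv [DecidableEq T] (A : SyncAlg) {P₀ : Fin n → Fin n}
    (hle : ∀ v, P₀ v ≤ v) (hroot : ∀ v, P₀ (P₀ v) = P₀ v) {c₀ c : SyncConfig T n}
    {H : List (Event (T ⊕ ℕ) n)}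
    (hc₀ : c₀ = { mem := Mem.start P₀, thr := fun _ => none, upd := none })
    (h : Run (SyncStep A) c₀ H c) :
    ∃ s : GState (syncSetting P₀) (T ⊕ ℕ), s.mem = c.mem ∧ Valid P₀ H s.label s.status ∧
      (∀ t, ThreadInv GuarQuery s (.inl t) (c.thr t)) ∧ UpdateInv s c.upd := by
  have hK : (syncSetting P₀).Descending := UFAlg.descending_of_major fun _ => rfl
  induction h with
  | nil =>
    subst hc₀
    exact ⟨.start _ _ hroot fun v hv => hK.prec_iff.2 (lt_of_le_of_ne (hle v) hv), rfl, .start,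
      fun _ => rfl, hroot, fun _ => rfl⟩
  | snoc _ hstep ih =>
    obtain ⟨s, hm, hv, ht, hu⟩ := ih
    cases hstep with
    | invoke t q hi =>
      have hs : s.status (.inl t) = {.idle} := (hi ▸ ht t : ThreadInv GuarQuery s (.inl t) none)
      refine ⟨s.setStatus (Function.update s.status (.inl t) {Status.pending q.toOp}), hm,
        hv.invoke (by simp [hs]), fun t' => ?_, hu.relyUpd ⟨rfl, rfl, fun i => by
          simp [setStatus, edgeOp]⟩⟩
      by_cases e : t' = t
      · subst e
        simp only [Function.update_self]
        exact Prog.query_wpt (by simp [setStatus])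
      · simp only [ne_eq, e, not_false_eq_true, Function.update_of_ne]
        exact (ht t').rely (s.rely_setStatus (by simp [e]))
    | step t p p' m' hp hstep =>
      have hw : ThreadInv GuarQuery s (.inl t) (some p) := hp ▸ ht t
      obtain ⟨s', hm', hg, hw'⟩ := Prog.wp_step (Rely.refl _) (fun _ _ _ => Rely.trans)
        (GuarQuery.refl _) hw (hm ▸ hstep)
      refine ⟨s', hm', by rw [List.append_nil]; exact hg.guar.valid _ hv, fun t' => ?_,
        hu.relyUpd hg.relyUpd⟩
      by_cases e : t' = t
      · subst e
        simp only [Function.update_self]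
        exact hw'
      · simpa [e] using (ht t').rely (hg.guar.rely (.inl t') (by simpa using e))
    | respond t r hr =>
      have hw : ThreadInv GuarQuery s (.inl t) (some (.ret r)) := hr ▸ ht t
      refine ⟨s.setStatus (Function.update s.status (.inl t) {Status.idle}), hm,
        hv.respond (hw s (.refl _ s)), fun t' => ?_, hu.relyUpd ⟨rfl, rfl, fun i => by
          simp [setStatus, edgeOp]⟩⟩
      by_cases e : t' = t
      · subst e
        simp only [Function.update_self]
        simp [ThreadInv, setStatus]
      · simp only [ne_eq, e, not_false_eq_true, Function.update_of_ne]
        exact (ht t').rely (s.rely_setStatus (by simp [e]))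
    | batchStart B hn =>
      have hu' : UpdateInv s none := hn ▸ hu
      refine ⟨s.setStatus (batchStatus s.status B), hm, hv.batchInv hu'.2 B,
        fun t => (ht t).rely (s.rely_setStatus rfl), Prog.update_wpu hK rfl A
          ⟨fun i hi => ?_, fun i e he => .inl ?_⟩ hu'.1⟩
      · simp [setStatus, batchStatus, hi]
      · simp [setStatus, batchStatus, he]
    | batchStep B p p' m' hp hstep =>
      have hw : UpdateInv s (some (B, p)) := hp ▸ hu
      obtain ⟨s', hm', hg, hw'⟩ := Prog.wp_step RelyUpd.refl (fun _ _ _ => RelyUpd.trans)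
        GuarUpd.refl hw (hm ▸ hstep)
      exact ⟨s', hm', by rw [List.append_nil]; exact hg.valid _ hv,
        fun t => (ht t).rely (hg.rely t), hw'⟩
    | batchEnd B hp =>
      have hw : UpdateInv s (some (B, .ret ())) := hp ▸ hu
      have hf := hw s (.refl s)
      exact ⟨s.setStatus (batchStatus s.status []), hm,
        hv.batchRes B hf.idle fun i e he => (hf.edge i e he).final,
        fun t => (ht t).rely (s.rely_setStatus rfl), hf.flat, fun i => by
          simp [setStatus, batchStatus]⟩

end ConnectIt

theorem mainTheorem8 {n : ℕ} {T : Type*} [DecidableEq T] (P₀ : Fin n → Fin n)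
    (hle : ∀ v, P₀ v ≤ v) (hroot : ∀ v, P₀ (P₀ v) = P₀ v) :
    (∀ (A : ConnectIt.UFAlg n) (H : List (ConnectIt.Event T n)),
      A.IsHistory P₀ H → ConnectIt.Linearizable P₀ H) ∧
    (∀ (A : ConnectIt.SyncAlg) (H : List (ConnectIt.Event (T ⊕ ℕ) n)),
      A.IsHistory P₀ H → ConnectIt.Linearizable P₀ H) := by
  refine ⟨fun A H ⟨c, h⟩ => ?_, fun A H ⟨c, h⟩ => ?_⟩
  · obtain ⟨s, -, hv, -⟩ := A.run_inv hle hroot rfl h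
    exact hv.linearizable
  · obtain ⟨s, -, hv, -⟩ := A.run_inv hle hroot rfl h
    exact hv.linearizable
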